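/- **Theorem 3.1 (Convergence).** Let $H_1$ be a complex Hilbert space, let $A$ be a (possibly unbounded) self-adjoint operator in $H_1$, and let $\Phi^A(t)=e^{-itA}$ be the strongly continuous one-parameter unitary group generated by $-iA$. Let $B:H_1\to H_1$ be a (possibly nonlinear) locally Lipschitz map. Let $(\alpha_n)_{n\in\mathbb N}$, $(\beta_n)_{n\in\mathbb N}$ be sequences of real-valued functions in $L^1_{\rm loc}(\mathbb R)$ such that - $\alpha_n\rightharpoonup 1$ and $\beta_n\rightharpoonup 1$, i.e. $\int_I\alpha_n\theta\,dt\to\int_I\theta\,dt$ and $\int_I\beta_n\theta\,dt\to\int_I\theta\,dt$ for every compact interval $I\subset\mathbb R$ and every continuous function $\theta$ on $I$; - $|\alpha_n|\le\bar\alpha$ and $|\beta_n|\le\bar\beta$ almost everywhere, for all $n$, for some $\bar\alpha,\bar\beta\in L^1_{\rm loc}(\mathbb R)$. For real functions $\alpha,\beta\in L^1_{\rm loc}(\mathbb R)$, $u_0\in H_1$ and $T\ge 0$, a solution on $[0,T]$ of $$ w_t+i\big(\alpha(t)A w+\beta(t)B(w)\big)=0,\qquad w(0)=u_0, $$ is a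 function $w\in C([0,T],H_1)$ such that, for all $t\in[0,T]$, $$ w(t)=\Phi^{A}\Big(\int_{0}^{t}\alpha(r)\,dr\Big)u_0-i\int_0^t\beta(s)\,\Phi^{A}\Big(\int_{s}^{t}\alpha(r)\,dr\Big)B(w(s))\,ds ; $$ its maximal existence time is the supremum, possibly $+\infty$, of all $T\ge0$ for which there is a solution on $[0,T]$. Let $T^*(u_0)$ be the maximal existence time for $\alpha=\beta=1$, that is, for the equation $u_t+iAu+iB(u)=0$, $u(0)=u_0$, and let $T_n^*(u_0)$ be the one for $\alpha=\alpha_n$, $\beta=\beta_n$. Let $u_0\in H_1$ and $0\le T<T^*(u_0)$. Then the problem with $\alpha=\beta=1$ has a unique solution $u$ on $[0,T]$, and there exists $n_0\in\mathbb N$ such that for every $n\ge n_0$ one has $T<T^*_n(u_0)$, the problem with $\alpha=\alpha_n$, $\beta=\beta_n$ has a unique solution $u_n$ on $[0,T]$, and $$ \lim_{n\to\infty}\ \max_{t\in[0,T]}\|u(t)-u_n(t)\|_{H_1}=0 . $$ -/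

import Mathlib

open Set Filter Topology MeasureTheory

namespace AbstractSplitting

/-- A sequence `f n` of (locally integrable) real functions on the line converges weakly to `g`:
for every compact interval `[a, b]` and every continuous function `θ` on `[a, b]`,
the integrals of `f n * θ` over `[a, b]` converge to the integral of `g * θ`. -/
def WeaklyConvergesTo (f : ℕ → ℝ → ℝ) (g : ℝ → ℝ) : Prop :=
  ∀ a b : ℝ, a ≤ b → ∀ θ : ℝ → ℝ, ContinuousOn θ (Icc a b) →
    Tendsto (fun n => ∫ t in a..b, f n t * θ t) atTop (𝓝 (∫ t in a..b, g t * θ t))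

variable {H : Type*} [NormedAddCommGroup H] [InnerProductSpace ℂ H] [CompleteSpace H]

/-- `U` is a strongly continuous one-parameter unitary group on `H` whose infinitesimal generator
is exactly `-i A`: a vector `v` lies in the domain of `A` with `A v = w` if and only if
`t ↦ U t v` is differentiable at `0` with derivative `-i w`. -/
structure IsUnitaryGroupGeneratedBy (A : H →ₗ.[ℂ] H) (U : ℝ → H →L[ℂ] H) : Prop where
  map_zero : U 0 = 1
  map_add : ∀ s t : ℝ, U (s + t) = U s * U t
  mem_unitary : ∀ t : ℝ, U t ∈ unitary (H →L[ℂ] H)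
  strongly_continuous : ∀ v : H, Continuous fun t => U t v
  generator : ∀ v w : H,
    (v, w) ∈ A.graph ↔ HasDerivAt (fun t : ℝ => U t v) (-(Complex.I • w)) 0

namespace IsUnitaryGroupGeneratedBy

theorem graph_apply {A : H →ₗ.[ℂ] H} {U : ℝ → H →L[ℂ] H} (hU : IsUnitaryGroupGeneratedBy A U)
    {v w : H} (h : (v, w) ∈ A.graph) (t : ℝ) : (U t v, U t w) ∈ A.graph := by
  rw [hU.generator] at h ⊢
  have h1 := ((U t).restrictScalars ℝ).hasFDerivAt.comp_hasDerivAt (0 : ℝ) h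
  have e : (fun s : ℝ => U s (U t v)) = (fun x => ((U t).restrictScalars ℝ) x) ∘ fun s => U s v := by
    funext s
    change (U s * U t) v = (U t * U s) v
    rw [← hU.map_add, ← hU.map_add, add_comm]
  rw [e]
  convert h1 using 1
  simp

theorem hasDerivAt {A : H →ₗ.[ℂ] H} {U : ℝ → H →L[ℂ] H} (hU : IsUnitaryGroupGeneratedBy A U)
    {v w : H} (h : (v, w) ∈ A.graph) (t : ℝ) :
    HasDerivAt (fun s : ℝ => U s v) (-(Complex.I • U t w)) t := by
  have h1 := (hU.generator _ _).1 (hU.graph_apply h t)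
  have h2 : HasDerivAt (fun s : ℝ => U s (U t v)) (-(Complex.I • U t w)) (t - t) := by
    rwa [sub_self]
  have h3 := h2.comp_sub_const t t
  have e : (fun s : ℝ => U s v) = fun s => U (s - t) (U t v) := by
    funext s
    change U s v = (U (s - t) * U t) v
    rw [← hU.map_add, sub_add_cancel]
  rw [e]
  exact h3

theorem norm_apply {A : H →ₗ.[ℂ] H} {U : ℝ → H →L[ℂ] H} (hU : IsUnitaryGroupGeneratedBy A U)
    (t : ℝ) (v : H) : ‖U t v‖ = ‖v‖ :=
  Unitary.norm_map ⟨U t, hU.mem_unitary t⟩ v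

/-- A strongly continuous unitary group is determined by its generator. -/
protected theorem unique {A : H →ₗ.[ℂ] H} (hA : Dense (A.domain : Set H))
    {U V : ℝ → H →L[ℂ] H} (hU : IsUnitaryGroupGeneratedBy A U)
    (hV : IsUnitaryGroupGeneratedBy A V) : U = V := by
  let _ : InnerProductSpace ℝ H := InnerProductSpace.rclikeToReal ℂ H
  funext t
  have key : ∀ v ∈ (A.domain : Set H), U t v = V t v := by
    intro v hv
    have hg : (v, A ⟨v, hv⟩) ∈ A.graph := A.mem_graph ⟨v, hv⟩
    set w := A ⟨v, hv⟩ with hw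
    have hskew : ∀ x y : H, (x, y) ∈ A.graph → inner ℝ x (-(Complex.I • y)) = (0 : ℝ) := by
      intro x y hxy
      have h1 := (hU.hasDerivAt hxy 0).norm_sq
      have e : (fun s : ℝ => ‖U s x‖ ^ 2) = fun _ => ‖x‖ ^ 2 := by
        funext s; rw [hU.norm_apply]
      rw [e] at h1
      have h2 := h1.unique (hasDerivAt_const _ _)
      simp only [hU.map_zero, one_apply_eq_self] at h2
      linarith
    have hd : ∀ s : ℝ, HasDerivAt (fun r : ℝ => ‖U r v - V r v‖ ^ 2) 0 s := by
      intro s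
      have h1 := ((hU.hasDerivAt hg s).sub (hV.hasDerivAt hg s)).norm_sq
      have h2 := hskew _ _ (A.graph.sub_mem (hU.graph_apply hg s) (hV.graph_apply hg s))
      have e : -(Complex.I • U s w) - -(Complex.I • V s w) =
          -(Complex.I • (U s w - V s w)) := by
        rw [smul_sub]; abel
      have h3 : inner ℝ (U s v - V s v) (-(Complex.I • U s w) - -(Complex.I • V s w)) = (0 : ℝ) := by
        rw [e]; exact h2
      have h4 := h1.congr_deriv (g' := 0) (by
        change 2 * inner ℝ (U s v - V s v) (-(Complex.I • U s w) - -(Complex.I • V s w)) = (0 : ℝ)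
        rw [h3, mul_zero])
      exact h4
    have hc := is_const_of_deriv_eq_zero (fun s => (hd s).differentiableAt)
      (fun s => (hd s).deriv) t 0
    simp only [hU.map_zero, hV.map_zero, sub_self, norm_zero] at hc
    have : ‖U t v - V t v‖ = 0 := by
      refine pow_eq_zero_iff (n := 2) (by norm_num) |>.1 ?_
      rw [hc]; norm_num
    exact sub_eq_zero.1 (norm_eq_zero.1 this)
  ext v
  exact congrFun (Continuous.ext_on hA (U t).continuous (V t).continuous key) v

end IsUnitaryGroupGeneratedBy

open Classical in
/-- The strongly continuous one-parameter unitary group `t ↦ Φ^A(t) = exp (-i t A)` generated by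
`-i A`. For a self-adjoint `A` it exists by Stone's theorem, and it is unique
(`IsUnitaryGroupGeneratedBy.unique`), so that the second branch plays no role. -/
noncomputable def unitaryGroup (A : H →ₗ.[ℂ] H) : ℝ → H →L[ℂ] H :=
  if h : ∃ U : ℝ → H →L[ℂ] H, IsUnitaryGroupGeneratedBy A U then h.choose else fun _ => 1

/-- The propagator `Φ^{A,α}(t₁, t₀) = Φ^A(∫_{t₀}^{t₁} α)`, which solves `v_t + i α(t) A v = 0`. -/
noncomputable def propagator (A : H →ₗ.[ℂ] H) (α : ℝ → ℝ) (t₁ t₀ : ℝ) : H →L[ℂ] H :=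
  unitaryGroup A (∫ t in t₀..t₁, α t)

/-- `w` is a (mild) solution on `[0, T]` of `w_t + i (α(t) A w + β(t) B(w)) = 0`, `w(0) = u₀`:
it is continuous on `[0, T]` with values in `H` and satisfies Duhamel's integral equation there.
For `α = β = 1` this is the autonomous equation `w_t + i A w + i B(w) = 0`. -/
def IsSolutionOn (A : H →ₗ.[ℂ] H) (B : H → H) (α β : ℝ → ℝ) (u₀ : H) (T : ℝ) (w : ℝ → H) :
    Prop :=
  ContinuousOn w (Icc 0 T) ∧ ∀ t ∈ Icc 0 T,
    w t = propagator A α t 0 u₀ -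
      Complex.I • ∫ s in (0 : ℝ)..t, (β s : ℂ) • propagator A α t s (B (w s))

/-- `w` is, on `[0, T]`, the one and only solution. -/
def IsUniqueSolutionOn (A : H →ₗ.[ℂ] H) (B : H → H) (α β : ℝ → ℝ) (u₀ : H) (T : ℝ)
    (w : ℝ → H) : Prop :=
  IsSolutionOn A B α β u₀ T w ∧ ∀ v, IsSolutionOn A B α β u₀ T v → EqOn v w (Icc 0 T)

/-- The maximal existence time `T*(u₀)`, possibly infinite: the supremum of all `T ≥ 0` such that
there is a solution on `[0, T]`. -/
noncomputable def maximalTime (A : H →ₗ.[ℂ] H) (B : H → H) (α β : ℝ → ℝ) (u₀ : H) : EReal :=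
  sSup ((fun T : ℝ => (T : EReal)) '' {T : ℝ | 0 ≤ T ∧ ∃ w, IsSolutionOn A B α β u₀ T w})

open Classical in
/-- The flow: `flow A B α β u₀ t` is the value at time `t` of the solution with initial value `u₀`
(and `0` if there is no solution up to time `t`). -/
noncomputable def flow (A : H →ₗ.[ℂ] H) (B : H → H) (α β : ℝ → ℝ) (u₀ : H) (t : ℝ) : H :=
  if h : ∃ w, IsSolutionOn A B α β u₀ t w then h.choose t else 0

end AbstractSplitting

namespace AbstractSplitting

/-! Put `a n t = ∫₀ᵗ α n`, and let `U` be the unitary group of `A`. In the interaction picture `v t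
= U (-a n t) (w t)`, Duhamel's formula becomes `v t = u₀ - i ∫₀ᵗ β n s • U (-a n s) (B (w s)) ds`,
in which `α n` enters only through its primitive (`isSolutionOn_iff`).

Domination gives the primitives a common modulus of continuity, so weak convergence makes `a n t →
t` and `∫₀ᵗ (β n - 1) → 0` uniformly. The latter persists after multiplication by a continuous
vector function, by approximation with step functions (`tendstoUniformlyOn_integral_smul`). Hence
the limit solution `u` satisfies the `n`-th integral equation up to a uniformly small error.

Since `B` is only locally Lipschitz, it is truncated to a tube around the compact trajectory of `u`.
The truncated problem is globally solvable (`exists_eq_add_integral_smul`), and Gronwall's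
inequality keeps its solution close to `u`, hence in the tube for large `n`, where the truncation
does nothing (`eventually_exists_isSolutionOn`). Doing this on `[0, S]` with `T < S < T*` yields
both `T < T*_n` and uniform convergence.

As `unitaryGroup` is defined by choice, Stone's theorem is needed to know that it really is the
group generated by `-iA`; it is proved by bounded commuting approximations. -/

theorem _root_.MeasureTheory.LocallyIntegrable.intervalIntegrable {E : Type*}
    [NormedAddCommGroup E] {f : ℝ → E} (hf : LocallyIntegrable f) {a b : ℝ} :
    IntervalIntegrable f volume a b :=
  intervalIntegrable_iff.2 <|
    (hf.integrableOn_isCompact isCompact_uIcc).mono_set uIoc_subset_uIcc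

/-! ### Gronwall's inequality with an integrable kernel. -/

section Primitives

/-- The primitive of `κ * exp (2 ∫ κ)`, for a locally integrable `κ`. -/
theorem integral_mul_exp_two_mul_primitive {κ : ℝ → ℝ} (hκ : LocallyIntegrable κ) (t : ℝ) :
    ∫ s in (0 : ℝ)..t, κ s * Real.exp (2 * ∫ r in (0 : ℝ)..s, κ r) =
      (Real.exp (2 * ∫ r in (0 : ℝ)..t, κ r) - 1) / 2 := by
  set b : ℝ → ℝ := fun s => ∫ r in (0 : ℝ)..s, κ r with hb
  have hbac : AbsolutelyContinuousOnInterval b 0 t :=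
    (hκ.intervalIntegrable (a := 0) (b := t)).absolutelyContinuousOnInterval_intervalIntegral
      (c := 0) (by simp)
  obtain ⟨C, hC⟩ := hbac.exists_bound
  obtain ⟨K, hK⟩ := (Real.contDiff_exp.comp (contDiff_const.mul contDiff_id) :
    ContDiff ℝ 1 (Real.exp ∘ fun x : ℝ => 2 * x)).contDiffOn.exists_lipschitzOnWith
      (s := Icc (-C) C) (by decide) (convex_Icc _ _) isCompact_Icc
  -- `b` is differentiable only almost everywhere, so the fundamental theorem of calculus is used
  -- for absolutely continuous functions; the exponential is Lipschitz on the bounded range of `b`.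
  have hac : AbsolutelyContinuousOnInterval (fun s => Real.exp (2 * b s)) 0 t := by
    unfold AbsolutelyContinuousOnInterval
    refine squeeze_zero' (Eventually.of_forall fun _ => Finset.sum_nonneg fun _ _ => dist_nonneg) ?_
      (by simpa using Tendsto.const_mul (K : ℝ) hbac)
    rw [eventually_inf_principal]
    refine Eventually.of_forall fun E hE => ?_
    rw [Finset.mul_sum]
    refine Finset.sum_le_sum fun i hi => ?_
    have h1 := hE.1 i hi
    exact hK.dist_le_mul _ (abs_le.1 (hC _ h1.1)) _ (abs_le.1 (hC _ h1.2))
  have h := hac.integral_deriv_eq_sub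
  have h2 : ∫ s in (0 : ℝ)..t, deriv (fun s => Real.exp (2 * b s)) s =
      ∫ s in (0 : ℝ)..t, 2 * (κ s * Real.exp (2 * b s)) := by
    refine intervalIntegral.integral_congr_ae ?_
    filter_upwards [_root_.LocallyIntegrable.ae_hasDerivAt_integral hκ] with s hs _
    rw [(((hs 0).const_mul 2).exp).deriv]
    ring
  rw [h2, intervalIntegral.integral_const_mul] at h
  have hb0 : b 0 = 0 := by simp [hb]
  rw [hb0, mul_zero, Real.exp_zero] at h
  linarith

theorem primitive_mono {κ : ℝ → ℝ} (hκ : LocallyIntegrable κ) (hκ0 : ∀ s, 0 ≤ κ s) :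
    Monotone fun t => ∫ r in (0 : ℝ)..t, κ r := by
  intro s t hst
  have := intervalIntegral.integral_interval_sub_left (hκ.intervalIntegrable (a := 0) (b := t))
    (hκ.intervalIntegrable (a := 0) (b := s))
  have h2 : 0 ≤ ∫ r in s..t, κ r := intervalIntegral.integral_nonneg hst fun r _ => hκ0 r
  simp only
  linarith

/-- Gronwall's inequality with an integrable kernel. -/
theorem le_of_le_add_integral_mul {κ h : ℝ → ℝ} {ε T : ℝ} (hκ : LocallyIntegrable κ)
    (hκ0 : ∀ s, 0 ≤ κ s) (hh : ContinuousOn h (Icc 0 T)) (hε : 0 ≤ ε)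
    (hle : ∀ t ∈ Icc 0 T, h t ≤ ε + ∫ s in (0 : ℝ)..t, κ s * h s) :
    ∀ t ∈ Icc 0 T, h t ≤ 2 * ε * Real.exp (2 * ∫ s in (0 : ℝ)..T, κ s) := by
  intro t ht
  set b : ℝ → ℝ := fun s => ∫ r in (0 : ℝ)..s, κ r with hb
  have hbc : Continuous b :=
    intervalIntegral.continuous_primitive (fun _ _ => hκ.intervalIntegrable) 0
  obtain ⟨t₀, ht₀, hmax⟩ := isCompact_Icc.exists_isMaxOn ⟨t, ht⟩
    (hh.mul (f := h) (g := fun s => Real.exp (-(2 * b s))) (by fun_prop))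
  set M := h t₀ * Real.exp (-(2 * b t₀)) with hM
  have hbd : ∀ s ∈ Icc 0 T, h s ≤ M * Real.exp (2 * b s) := by
    intro s hs
    have h1 : h s * Real.exp (-(2 * b s)) ≤ M := hmax hs
    rw [Real.exp_neg, ← div_eq_mul_inv, div_le_iff₀ (Real.exp_pos _)] at h1
    exact h1
  -- At the maximum point the integral is at most `M (exp (2b) - 1) / 2`. The 2 in the weight
  -- produces this factor 1/2, which lets the left side absorb it.
  have hM2 : M ≤ 2 * ε := by
    by_cases hM0 : M ≤ 0
    · linarith
    push Not at hM0
    have hsub : Icc 0 t₀ ⊆ Icc 0 T := Icc_subset_Icc_right ht₀.2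
    have h1 : ∫ s in (0 : ℝ)..t₀, κ s * h s ≤
        ∫ s in (0 : ℝ)..t₀, M * (κ s * Real.exp (2 * b s)) := by
      refine intervalIntegral.integral_mono_on ht₀.1
        (hκ.intervalIntegrable.mul_continuousOn (hh.mono ((uIcc_of_le ht₀.1).trans_subset hsub)))
        ((hκ.intervalIntegrable.mul_continuousOn (by fun_prop)).const_mul M) fun s hs => ?_
      have := mul_le_mul_of_nonneg_left (hbd s (hsub hs)) (hκ0 s)
      linarith
    rw [intervalIntegral.integral_const_mul, integral_mul_exp_two_mul_primitive hκ] at h1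
    have h2 := hle t₀ ht₀
    have h3 : h t₀ = M * Real.exp (2 * b t₀) := by
      rw [hM, mul_assoc, ← Real.exp_add]; simp
    have hb0 : 0 ≤ b t₀ := intervalIntegral.integral_nonneg ht₀.1 fun r _ => hκ0 r
    have h4 : 1 ≤ Real.exp (2 * b t₀) := Real.one_le_exp (by linarith)
    change _ ≤ M * ((Real.exp (2 * b t₀) - 1) / 2) at h1
    nlinarith
  calc h t ≤ M * Real.exp (2 * b t) := hbd t ht
    _ ≤ 2 * ε * Real.exp (2 * b t) := by gcongr
    _ ≤ 2 * ε * Real.exp (2 * b T) := by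
      gcongr
      exact primitive_mono hκ hκ0 ht.2

end Primitives

/-! ### Uniform convergence of primitives of dominated sequences. -/

section UniformConvergence

/-- On a compact set, uniform convergence to a continuous function is continuous convergence. -/
theorem tendstoUniformlyOn_iff_forall_tendsto_prod {ι X Y : Type*} [TopologicalSpace X]
    [UniformSpace Y] {p : Filter ι} {F : ι → X → Y} {f : X → Y} {s : Set X} (hs : IsCompact s)
    (hf : ContinuousOn f s) :
    TendstoUniformlyOn F f p s ↔
      ∀ x ∈ s, Tendsto (fun q : ι × X => F q.1 q.2) (p ×ˢ 𝓝[s] x) (𝓝 (f x)) := by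
  rw [← tendstoLocallyUniformlyOn_iff_tendstoUniformlyOn_of_compact hs,
    tendstoLocallyUniformlyOn_iff_forall_tendsto]
  refine forall₂_congr fun x hx => ?_
  have hfx : Tendsto (fun q : ι × X => f q.2) (p ×ˢ 𝓝[s] x) (𝓝 (f x)) :=
    (hf x hx).tendsto.comp tendsto_snd
  constructor
  · intro h
    exact (Uniform.tendsto_congr h).1 hfx
  · intro h
    exact (hfx.prodMk_nhds h).mono_right (nhds_le_uniformity _)

/-- Continuous convergence is stable under composition, so `q` need not be uniformly continuous. -/
theorem tendstoUniformlyOn_comp_prodMk {ι Y : Type*} [UniformSpace Y] {p : Filter ι}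
    {a : ι → ℝ → ℝ} {a₀ : ℝ → ℝ} {s : Set ℝ} (hs : IsCompact s) (ha₀ : ContinuousOn a₀ s)
    (ha : TendstoUniformlyOn a a₀ p s) {q : ℝ → ℝ → Y} (hq : Continuous (Function.uncurry q)) :
    TendstoUniformlyOn (fun n t => q (a n t) t) (fun t => q (a₀ t) t) p s := by
  have hc : ContinuousOn (fun t => q (a₀ t) t) s :=
    hq.comp_continuousOn (ha₀.prodMk continuousOn_id)
  rw [tendstoUniformlyOn_iff_forall_tendsto_prod hs hc]
  intro x hx
  have h1 := (tendstoUniformlyOn_iff_forall_tendsto_prod hs ha₀).1 ha x hx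
  have h2 : Tendsto (fun q : ι × ℝ => q.2) (p ×ˢ 𝓝[s] x) (𝓝 x) :=
    tendsto_snd.mono_right nhdsWithin_le_nhds
  exact (hq.tendsto (a₀ x, x)).comp (h1.prodMk_nhds h2)

variable {E : Type*} [NormedAddCommGroup E] [NormedSpace ℝ E] [CompleteSpace E]

/-- Primitives of a dominated sequence which converge pointwise converge uniformly. -/
theorem tendstoUniformlyOn_primitive {γ : ℕ → ℝ → ℝ} {γbar : ℝ → ℝ} {c : ℝ → ℝ} {S : ℝ}
    (hγ : ∀ n, LocallyIntegrable (γ n)) (hγbar : LocallyIntegrable γbar)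
    (hdom : ∀ n, ∀ᵐ t, |γ n t| ≤ γbar t) (hc : Continuous c)
    (hlim : ∀ t ∈ Icc 0 S, Tendsto (fun n => ∫ s in (0 : ℝ)..t, γ n s) atTop (𝓝 (c t))) :
    TendstoUniformlyOn (fun n t => ∫ s in (0 : ℝ)..t, γ n s) c atTop (Icc 0 S) := by
  rw [tendstoUniformlyOn_iff_forall_tendsto_prod isCompact_Icc hc.continuousOn]
  intro x hx
  have hg : Continuous fun t => ∫ s in (0 : ℝ)..t, γbar s :=
    intervalIntegral.continuous_primitive (fun _ _ => hγbar.intervalIntegrable) 0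
  -- The primitive of `γbar` is a modulus of continuity common to all `n`.
  have key : ∀ n t, |(∫ s in (0 : ℝ)..t, γ n s) - ∫ s in (0 : ℝ)..x, γ n s| ≤
      |(∫ s in (0 : ℝ)..t, γbar s) - ∫ s in (0 : ℝ)..x, γbar s| := by
    intro n t
    rw [intervalIntegral.integral_interval_sub_left (hγ n).intervalIntegrable
      (hγ n).intervalIntegrable, intervalIntegral.integral_interval_sub_left
      hγbar.intervalIntegrable hγbar.intervalIntegrable]
    exact intervalIntegral.norm_integral_le_abs_of_norm_le (f := γ n)
      (ae_restrict_of_ae (hdom n)) hγbar.intervalIntegrable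
  have h1 : Tendsto (fun q : ℕ × ℝ => |(∫ s in (0 : ℝ)..q.2, γbar s) -
      ∫ s in (0 : ℝ)..x, γbar s|) (atTop ×ˢ 𝓝[Icc 0 S] x) (𝓝 0) := by
    have h2 : Tendsto (fun q : ℕ × ℝ => q.2) (atTop ×ˢ 𝓝[Icc 0 S] x) (𝓝 x) :=
      tendsto_snd.mono_right nhdsWithin_le_nhds
    have h3 := (((hg.tendsto x).comp h2).sub_const (∫ s in (0 : ℝ)..x, γbar s)).abs
    simpa using h3
  have h4 : Tendsto (fun q : ℕ × ℝ => (∫ s in (0 : ℝ)..q.2, γ q.1 s) -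
      ∫ s in (0 : ℝ)..x, γ q.1 s) (atTop ×ˢ 𝓝[Icc 0 S] x) (𝓝 0) :=
    squeeze_zero_norm (fun q => key q.1 q.2) h1
  simpa using h4.add ((hlim x hx).comp tendsto_fst)

/-- If the primitives of a dominated sequence `γ n` tend to zero uniformly, then so do those of
`γ n • g`, for a continuous vector-valued function `g`. -/
theorem tendstoUniformlyOn_integral_smul {γ : ℕ → ℝ → ℝ} {γbar : ℝ → ℝ} {g : ℝ → E} {S : ℝ}
    (hγ : ∀ n, LocallyIntegrable (γ n)) (hγbar : LocallyIntegrable γbar)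
    (hdom : ∀ n, ∀ᵐ t, |γ n t| ≤ γbar t) (hg : Continuous g)
    (hlim : TendstoUniformlyOn (fun n t => ∫ s in (0 : ℝ)..t, γ n s) (fun _ => 0) atTop (Icc 0 S)) :
    TendstoUniformlyOn (fun n t => ∫ s in (0 : ℝ)..t, γ n s • g s) (fun _ => 0) atTop
      (Icc 0 S) := by
  rcases lt_or_ge S 0 with hS | hS
  · rw [Icc_eq_empty (not_le.2 hS)]
    exact tendstoUniformlyOn_empty
  have hγbar0 : ∀ᵐ t, 0 ≤ γbar t := (hdom 0).mono fun t ht => (abs_nonneg _).trans ht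
  set I := ∫ s in (0 : ℝ)..S, γbar s with hI
  have hI0 : 0 ≤ I := intervalIntegral.integral_nonneg_of_ae hS hγbar0
  obtain ⟨M, hM⟩ := isCompact_Icc.exists_bound_of_continuousOn (s := Icc 0 S) hg.continuousOn
  have hM0 : 0 ≤ M := (norm_nonneg _).trans (hM 0 ⟨le_rfl, hS⟩)
  rw [Metric.tendstoUniformlyOn_iff]
  intro ε hε
  -- `η` bounds the oscillation of `g` on a mesh interval, and `ζ` below the primitives of `γ n` at
  -- the mesh points. The two errors add up to `η I + 2 N ζ M`; the `+ 1`s avoid division by zero.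
  set η := ε / (2 * (I + 1)) with hη
  have hηpos : 0 < η := by positivity
  obtain ⟨δ, hδ, hgδ⟩ := Metric.uniformContinuousOn_iff.1
    (isCompact_Icc.uniformContinuousOn_of_continuous (s := Icc 0 S) hg.continuousOn) η hηpos
  obtain ⟨N, hN⟩ := exists_nat_gt (S / δ)
  have hNpos : (0 : ℝ) < N := lt_of_le_of_lt (by positivity) hN
  set ζ := ε / (4 * (N * (M + 1))) with hζ
  have hζpos : 0 < ζ := by positivity
  filter_upwards [Metric.tendstoUniformlyOn_iff.1 hlim ζ hζpos] with n hn t ht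
  rw [dist_zero_left]
  -- The mesh depends on `t`, but its size is at most `S / N < δ` with `N` independent of `t` and
  -- `n`.
  set x : ℕ → ℝ := fun j => j * (t / N) with hx
  have htN : 0 ≤ t / N := div_nonneg ht.1 hNpos.le
  have hx0 : x 0 = 0 := by simp [hx]
  have hxN : x N = t := by simp only [hx]; field_simp
  have hxs : ∀ j, x (j + 1) = x j + t / N := fun j => by simp only [hx]; push_cast; ring
  have hxmem : ∀ j ≤ N, x j ∈ Icc 0 S := fun j hj => by
    refine ⟨by positivity, le_trans ?_ ht.2⟩
    calc x j ≤ x N := mul_le_mul_of_nonneg_right (by exact_mod_cast hj) htN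
      _ = t := hxN
  have hii : ∀ a b, IntervalIntegrable (fun s => γ n s • g s) volume a b := fun a b =>
    (hγ n).intervalIntegrable.smul_continuousOn hg.continuousOn
  have hsum := intervalIntegral.sum_integral_adjacent_intervals (f := fun s => γ n s • g s)
    (μ := volume) (a := x) (n := N) fun k _ => hii _ _
  have hsum2 := intervalIntegral.sum_integral_adjacent_intervals (f := γbar)
    (μ := volume) (a := x) (n := N) fun k _ => hγbar.intervalIntegrable
  rw [hx0, hxN] at hsum hsum2
  have hterm : ∀ j ∈ Finset.range N, ‖∫ s in x j..x (j + 1), γ n s • g s‖ ≤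
      η * (∫ s in x j..x (j + 1), γbar s) + 2 * ζ * M := by
    intro j hj
    have hj' : j < N := Finset.mem_range.1 hj
    have hle : x j ≤ x (j + 1) := by rw [hxs]; linarith
    have hxj := hxmem j hj'.le
    have hxj1 := hxmem (j + 1) hj'
    -- Freeze `g` at the left endpoint.
    have e : (∫ s in x j..x (j + 1), γ n s • g s) =
        (∫ s in x j..x (j + 1), γ n s • (g s - g (x j))) +
          (∫ s in x j..x (j + 1), γ n s) • g (x j) := by
      rw [← intervalIntegral.integral_smul_const, ← intervalIntegral.integral_add]
      · simp only [smul_sub, sub_add_cancel]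
      · exact (hγ n).intervalIntegrable.smul_continuousOn (by fun_prop)
      · exact (hγ n).intervalIntegrable.smul_continuousOn (by fun_prop)
    rw [e]
    refine (norm_add_le _ _).trans (add_le_add ?_ ?_)
    · rw [← intervalIntegral.integral_const_mul]
      refine intervalIntegral.norm_integral_le_of_norm_le hle ?_
        (hγbar.intervalIntegrable.const_mul η)
      filter_upwards [hdom n] with s hs hsI
      rw [norm_smul, mul_comm]
      have h1 : dist (g s) (g (x j)) < η := by
        refine hgδ s ⟨hxj.1.trans hsI.1.le, hsI.2.trans hxj1.2⟩ _ hxj ?_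
        rw [Real.dist_eq, abs_of_pos (by linarith [hsI.1])]
        have h2 : s ≤ x j + t / N := by rw [← hxs]; exact hsI.2
        have h3 : t / N < δ := by
          rw [div_lt_iff₀ hNpos]
          rw [div_lt_iff₀ hδ] at hN
          linarith [ht.2]
        linarith
      rw [← dist_eq_norm]
      exact mul_le_mul h1.le hs (norm_nonneg _) hηpos.le
    · rw [norm_smul]
      refine mul_le_mul ?_ (hM _ hxj) (norm_nonneg _) (by positivity)
      rw [← intervalIntegral.integral_interval_sub_left (hγ n).intervalIntegrable
        (hγ n).intervalIntegrable (a := 0)]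
      have h1 := hn _ hxj
      have h2 := hn _ hxj1
      rw [dist_zero_left] at h1 h2
      exact (norm_sub_le _ _).trans (by linarith)
  have hIt : ∫ s in (0 : ℝ)..t, γbar s ≤ I := by
    have h1 := intervalIntegral.integral_interval_sub_left
      (hγbar.intervalIntegrable (a := 0) (b := S)) (hγbar.intervalIntegrable (a := 0) (b := t))
    have h2 : 0 ≤ ∫ s in t..S, γbar s := intervalIntegral.integral_nonneg_of_ae ht.2 hγbar0
    linarith
  calc ‖∫ s in (0 : ℝ)..t, γ n s • g s‖
      ≤ ∑ j ∈ Finset.range N, ‖∫ s in x j..x (j + 1), γ n s • g s‖ := by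
        rw [← hsum]; exact norm_sum_le _ _
    _ ≤ ∑ j ∈ Finset.range N, (η * (∫ s in x j..x (j + 1), γbar s) + 2 * ζ * M) :=
        Finset.sum_le_sum hterm
    _ = η * (∫ s in (0 : ℝ)..t, γbar s) + N * (2 * ζ * M) := by
        rw [Finset.sum_add_distrib, ← Finset.mul_sum, hsum2]; simp
    _ ≤ η * I + N * (2 * ζ * M) := by gcongr
    _ < η * (I + 1) + N * (2 * ζ * (M + 1)) := by
        have : (N : ℝ) * (2 * ζ * M) ≤ N * (2 * ζ * (M + 1)) := by gcongr; linarith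
        nlinarith
    _ = ε := by rw [hη, hζ]; field_simp; ring

end UniformConvergence

theorem _root_.MeasureTheory.LocallyIntegrable.const_mul_abs {γ : ℝ → ℝ}
    (hγ : LocallyIntegrable γ) (c : ℝ) : LocallyIntegrable fun s => c * |γ s| :=
  LocallyIntegrable.smul (f := fun s => |γ s|) (fun x => (hγ x).norm) c

/-! ### Global solvability of Volterra equations. -/

section Volterra

variable {E : Type*} [NormedAddCommGroup E] [NormedSpace ℝ E] [CompleteSpace E]

/-- Global solvability of `v' = γ(t) g(t, v)` for an integrable `γ` and a globally Lipschitz `g`. -/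
theorem exists_eq_add_integral_smul {g : ℝ → E → E} (hg : Continuous (Function.uncurry g))
    {L : NNReal} (hL : ∀ s, LipschitzWith L (g s)) {γ : ℝ → ℝ} (hγ : LocallyIntegrable γ)
    (u₀ : E) {T : ℝ} (hT : 0 ≤ T) :
    ∃ v : ℝ → E, Continuous v ∧ ∀ t ∈ Icc 0 T, v t = u₀ + ∫ s in (0 : ℝ)..t, γ s • g s (v s) := by
  set κ : ℝ → ℝ := fun s => L * |γ s| with hκdef
  have hκ : LocallyIntegrable κ := hγ.const_mul_abs L
  have hκ0 : ∀ s, 0 ≤ κ s := fun s => by positivity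
  set b : ℝ → ℝ := fun s => ∫ r in (0 : ℝ)..s, κ r with hb
  have hbc : Continuous b :=
    intervalIntegral.continuous_primitive (fun _ _ => hκ.intervalIntegrable) 0
  have hexp : Continuous fun s => Real.exp (2 * b s) := by fun_prop
  -- The unknown is `z = exp (-2b) v`: in this weighted norm the integral operator contracts by 1/2
  -- on all of `[0, T]`, so no iteration over short intervals is needed.
  let V : C(Icc (0 : ℝ) T, E) → ℝ → E := fun z s => Real.exp (2 * b s) • IccExtend hT z s
  have hV : ∀ z, Continuous (V z) := fun z =>
    hexp.smul z.continuous.Icc_extend'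
  have hgV : ∀ z, Continuous fun s => g s (V z s) := fun z =>
    hg.comp (continuous_id.prodMk (hV z))
  have hii : ∀ z t, IntervalIntegrable (fun s => γ s • g s (V z s)) volume 0 t := fun z t =>
    hγ.intervalIntegrable.smul_continuousOn (hgV z).continuousOn
  let F : C(Icc (0 : ℝ) T, E) → ℝ → E := fun z t => u₀ + ∫ s in (0 : ℝ)..t, γ s • g s (V z s)
  have hF : ∀ z, Continuous (F z) := fun z => continuous_const.add <|
    intervalIntegral.continuous_primitive
      (fun _ _ => hγ.intervalIntegrable.smul_continuousOn (hgV z).continuousOn) 0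
  let Ψ : C(Icc (0 : ℝ) T, E) → C(Icc (0 : ℝ) T, E) := fun z =>
    ⟨fun t => Real.exp (-(2 * b t)) • F z t, by have := hF z; fun_prop⟩
  have hΨ : ContractingWith (1 / 2) Ψ := by
    refine ⟨by norm_num, LipschitzWith.of_dist_le_mul fun z₁ z₂ => ?_⟩
    rw [ContinuousMap.dist_le (by positivity)]
    rintro ⟨t, ht⟩
    have hd : ∀ s, ‖IccExtend hT z₁ s - IccExtend hT z₂ s‖ ≤ dist z₁ z₂ := fun s => by
      rw [← dist_eq_norm]
      exact ContinuousMap.dist_apply_le_dist _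
    have h1 : ‖F z₁ t - F z₂ t‖ ≤ dist z₁ z₂ * ((Real.exp (2 * b t) - 1) / 2) := by
      rw [← integral_mul_exp_two_mul_primitive hκ, ← intervalIntegral.integral_const_mul]
      simp only [F, add_sub_add_left_eq_sub]
      rw [← intervalIntegral.integral_sub (hii _ _) (hii _ _)]
      refine intervalIntegral.norm_integral_le_of_norm_le ht.1 (Eventually.of_forall fun s _ => ?_)
        ((hκ.intervalIntegrable.mul_continuousOn hexp.continuousOn).const_mul _)
      rw [← smul_sub, norm_smul, ← dist_eq_norm]
      calc ‖γ s‖ * dist (g s (V z₁ s)) (g s (V z₂ s))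
          ≤ ‖γ s‖ * (L * dist (V z₁ s) (V z₂ s)) := by gcongr; exact (hL s).dist_le_mul _ _
        _ ≤ ‖γ s‖ * (L * (Real.exp (2 * b s) * dist z₁ z₂)) := by
            gcongr
            simp only [V]
            rw [dist_smul₀, Real.norm_eq_abs, Real.abs_exp]
            gcongr
            rw [dist_eq_norm]
            exact hd s
        _ = dist z₁ z₂ * (κ s * Real.exp (2 * b s)) := by
            rw [hκdef, Real.norm_eq_abs]; ring
    calc dist (Real.exp (-(2 * b t)) • F z₁ t) (Real.exp (-(2 * b t)) • F z₂ t)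
        = Real.exp (-(2 * b t)) * ‖F z₁ t - F z₂ t‖ := by
          rw [dist_smul₀, Real.norm_eq_abs, Real.abs_exp, dist_eq_norm]
      _ ≤ Real.exp (-(2 * b t)) * (dist z₁ z₂ * ((Real.exp (2 * b t) - 0) / 2)) := by
          gcongr
          refine h1.trans ?_
          gcongr
          norm_num
      _ = ((1 / 2 : NNReal) : ℝ) * dist z₁ z₂ := by
          rw [Real.exp_neg]
          push_cast
          field_simp
          ring
  have : Nonempty C(Icc (0 : ℝ) T, E) := ⟨0⟩
  set z := hΨ.fixedPoint Ψ
  have hz : Ψ z = z := hΨ.fixedPoint_isFixedPt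
  refine ⟨V z, hV z, fun t ht => ?_⟩
  have h2 : IccExtend hT z t = Real.exp (-(2 * b t)) • F z t := by
    rw [IccExtend_of_mem hT z ht]
    exact (congrArg (fun y : C(Icc (0 : ℝ) T, E) => y ⟨t, ht⟩) hz).symm
  change Real.exp (2 * b t) • IccExtend hT z t = F z t
  rw [h2, smul_smul, ← Real.exp_add]
  simp

end Volterra

/-! ### Uniform Lipschitz bounds near compact sets, and radial truncation. -/

section Lipschitz

/-- A locally Lipschitz map is uniformly Lipschitz on small balls centred on a compact set. -/
theorem _root_.LocallyLipschitz.exists_lipschitzOnWith_closedBall {X Y : Type*}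
    [PseudoMetricSpace X] [PseudoEMetricSpace Y] {B : X → Y} (hB : LocallyLipschitz B) {K : Set X}
    (hK : IsCompact K) :
    ∃ δ > 0, ∃ L : NNReal, ∀ x ∈ K, LipschitzOnWith L B (Metric.closedBall x δ) := by
  choose C t ht hLip using hB
  obtain ⟨I, -, hI⟩ := hK.elim_nhds_subcover (fun x => interior (t x))
    fun x _ => interior_mem_nhds.2 (ht x)
  obtain ⟨δ, hδ, h⟩ := lebesgue_number_lemma_of_metric (ι := I) (c := fun i => interior (t i)) hK
    (fun _ => isOpen_interior) (by simpa [iUnion_subtype] using hI)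
  refine ⟨δ / 2, by positivity, I.sup C, fun x hx => ?_⟩
  obtain ⟨i, hi⟩ := h x hx
  refine ((hLip i).mono ?_).weaken (Finset.le_sup i.2)
  exact (Metric.closedBall_subset_ball (by linarith)).trans (hi.trans interior_subset)

variable {E : Type*} [NormedAddCommGroup E] [NormedSpace ℝ E]

/-- The radial retraction of a normed space onto the closed ball of radius `δ`. -/
noncomputable def radialRetraction (δ : ℝ) (z : E) : E := (δ / max δ ‖z‖) • z

variable {δ : ℝ}

theorem norm_radialRetraction_le (hδ : 0 < δ) (z : E) : ‖radialRetraction δ z‖ ≤ δ := by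
  have hm : 0 < max δ ‖z‖ := lt_max_of_lt_left hδ
  rw [radialRetraction, norm_smul, Real.norm_eq_abs, abs_of_nonneg (by positivity),
    div_mul_eq_mul_div, div_le_iff₀ hm]
  gcongr
  exact le_max_right _ _

theorem radialRetraction_of_norm_le (hδ : 0 < δ) {z : E} (hz : ‖z‖ ≤ δ) :
    radialRetraction δ z = z := by
  rw [radialRetraction, max_eq_left hz, div_self hδ.ne', one_smul]

/-- One unit of the constant comes from scaling `x - y` by a factor at most 1, the other from the
change of that factor, which is applied to `y` and controlled by `‖y‖ ≤ max δ ‖y‖`. -/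
theorem lipschitzWith_radialRetraction (hδ : 0 < δ) :
    LipschitzWith 2 (radialRetraction δ : E → E) := by
  refine LipschitzWith.of_dist_le_mul fun x y => ?_
  have hx : 0 < max δ ‖x‖ := lt_max_of_lt_left hδ
  have hy : 0 < max δ ‖y‖ := lt_max_of_lt_left hδ
  have e : radialRetraction δ x - radialRetraction δ y =
      (δ / max δ ‖x‖) • (x - y) + (δ / max δ ‖x‖ - δ / max δ ‖y‖) • y := by
    simp only [radialRetraction, smul_sub, sub_smul]
    abel
  have h1 : δ / max δ ‖x‖ ≤ 1 := (div_le_one hx).2 (le_max_left _ _)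
  have h2 : |δ / max δ ‖x‖ - δ / max δ ‖y‖| * ‖y‖ ≤ ‖x - y‖ := by
    have h3 : |max δ ‖y‖ - max δ ‖x‖| ≤ ‖x - y‖ := by
      refine (abs_max_sub_max_le_max _ _ _ _).trans ?_
      rw [sub_self, abs_zero, max_eq_right (abs_nonneg _), norm_sub_rev]
      exact abs_norm_sub_norm_le _ _
    have h4 : δ / max δ ‖x‖ - δ / max δ ‖y‖ =
        (δ / max δ ‖x‖) * (max δ ‖y‖ - max δ ‖x‖) / max δ ‖y‖ := by
      field_simp
    rw [h4, abs_div, abs_mul, abs_of_pos hy, abs_of_nonneg (div_nonneg hδ.le hx.le),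
      div_mul_eq_mul_div, div_le_iff₀ hy]
    calc δ / max δ ‖x‖ * |max δ ‖y‖ - max δ ‖x‖| * ‖y‖ ≤ 1 * ‖x - y‖ * max δ ‖y‖ := by
          gcongr
          exact le_max_right _ _
      _ = ‖x - y‖ * max δ ‖y‖ := by rw [one_mul]
  rw [dist_eq_norm, dist_eq_norm, e]
  refine (norm_add_le _ _).trans ?_
  rw [norm_smul, norm_smul, Real.norm_eq_abs, Real.norm_eq_abs,
    abs_of_nonneg (div_nonneg hδ.le hx.le)]
  have := mul_le_mul_of_nonneg_right h1 (norm_nonneg (x - y))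
  push_cast
  linarith

end Lipschitz

/-! ### Unitary groups with bounded generator. -/

section BoundedGenerator

variable {H : Type*} [NormedAddCommGroup H] [InnerProductSpace ℂ H] [CompleteSpace H]

/-- The group `t ↦ exp (t X)` generated by a bounded operator `X`; it is unitary if `X` is
skew-adjoint. -/
noncomputable def expGroup (X : H →L[ℂ] H) (t : ℝ) : H →L[ℂ] H := NormedSpace.exp (t • X)

theorem expGroup_zero (X : H →L[ℂ] H) : expGroup X 0 = 1 := by
  simp [expGroup]

theorem expGroup_add_of_commute {X Y : H →L[ℂ] H} (h : Commute X Y) (t : ℝ) :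
    expGroup (X + Y) t = expGroup X t * expGroup Y t := by
  let +nondep : NormedAlgebra ℚ (H →L[ℂ] H) := .restrictScalars ℚ ℂ _
  rw [expGroup, smul_add, NormedSpace.exp_add_of_commute ((h.smul_left t).smul_right t)]
  rfl

theorem expGroup_add (X : H →L[ℂ] H) (s t : ℝ) :
    expGroup X (s + t) = expGroup X s * expGroup X t := by
  let +nondep : NormedAlgebra ℚ (H →L[ℂ] H) := .restrictScalars ℚ ℂ _
  rw [expGroup, add_smul,
    NormedSpace.exp_add_of_commute (((Commute.refl X).smul_left s).smul_right t)]
  rfl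

theorem hasDerivAt_expGroup_apply (X : H →L[ℂ] H) (v : H) (t : ℝ) :
    HasDerivAt (fun s => expGroup X s v) (expGroup X t (X v)) t :=
  (((ContinuousLinearMap.apply ℂ H v).restrictScalars ℝ).hasFDerivAt.comp_hasDerivAt t
    (hasDerivAt_exp_smul_const (𝕂 := ℝ) X t) :)

theorem expGroup_mem_unitary {X : H →L[ℂ] H} (hX : X ∈ skewAdjoint (H →L[ℂ] H)) (t : ℝ) :
    expGroup X t ∈ unitary (H →L[ℂ] H) := by
  let +nondep : NormedAlgebra ℚ (H →L[ℂ] H) := .restrictScalars ℚ ℂ _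
  exact NormedSpace.exp_mem_unitary_of_mem_skewAdjoint (skewAdjoint.smul_mem t hX)

theorem norm_expGroup_apply {X : H →L[ℂ] H} (hX : X ∈ skewAdjoint (H →L[ℂ] H)) (t : ℝ) (v : H) :
    ‖expGroup X t v‖ = ‖v‖ :=
  ContinuousLinearMap.norm_map_of_mem_unitary (expGroup_mem_unitary hX t) v

theorem norm_expGroup_apply_sub_self_le {X : H →L[ℂ] H} (hX : X ∈ skewAdjoint (H →L[ℂ] H))
    (t : ℝ) (v : H) : ‖expGroup X t v - v‖ ≤ |t| * ‖X v‖ := by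
  have h := Convex.norm_image_sub_le_of_norm_hasDerivWithin_le (s := univ) (x := (0 : ℝ)) (y := t)
    (f := fun s => expGroup X s v) (C := ‖X v‖)
    (fun s _ => (hasDerivAt_expGroup_apply X v s).hasDerivWithinAt)
    (fun s _ => (norm_expGroup_apply hX s (X v)).le) convex_univ (mem_univ _) (mem_univ _)
  simpa [expGroup_zero, mul_comm] using h

/-- By commutation `exp (tX) = exp (tY) exp (t(X - Y))`, and the first factor is an isometry. Only
`‖X v - Y v‖` enters, not an operator norm, so strong convergence of generators suffices. -/
theorem norm_expGroup_apply_sub_le {X Y : H →L[ℂ] H} (hX : X ∈ skewAdjoint (H →L[ℂ] H))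
    (hY : Y ∈ skewAdjoint (H →L[ℂ] H)) (hXY : Commute X Y) (t : ℝ) (v : H) :
    ‖expGroup X t v - expGroup Y t v‖ ≤ |t| * ‖X v - Y v‖ := by
  have hc : Commute Y (X - Y) := hXY.symm.sub_right (Commute.refl Y)
  have e : expGroup X t v = expGroup Y t (expGroup (X - Y) t v) := by
    conv_lhs => rw [← add_sub_cancel Y X, expGroup_add_of_commute hc]
    rfl
  rw [e, ← map_sub, norm_expGroup_apply hY]
  exact norm_expGroup_apply_sub_self_le (sub_mem hX hY) t v

theorem continuous_expGroup_apply (X : H →L[ℂ] H) (v : H) : Continuous fun t => expGroup X t v :=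
  continuous_iff_continuousAt.2 fun t => (hasDerivAt_expGroup_apply X v t).continuousAt

theorem expGroup_apply_sub_self_eq_integral (X : H →L[ℂ] H) (v : H) (t : ℝ) :
    expGroup X t v - v = ∫ s in (0 : ℝ)..t, expGroup X s (X v) := by
  rw [intervalIntegral.integral_eq_sub_of_hasDerivAt
    (fun s _ => hasDerivAt_expGroup_apply X v s)
    ((continuous_expGroup_apply X (X v)).intervalIntegrable _ _), expGroup_zero]
  rfl

end BoundedGenerator

/-! ### Strong limits of commuting unitary groups. -/

section Limit

variable {H : Type*} [NormedAddCommGroup H] [InnerProductSpace ℂ H] [CompleteSpace H]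

theorem cauchySeq_expGroup_apply {X : ℕ → H →L[ℂ] H}
    (hX : ∀ n, X n ∈ skewAdjoint (H →L[ℂ] H)) (hc : ∀ m n, Commute (X m) (X n)) {D : Set H}
    (hD : Dense D) (hlim : ∀ v ∈ D, ∃ w, Tendsto (fun n => X n v) atTop (𝓝 w)) (t : ℝ) (v : H) :
    CauchySeq fun n => expGroup (X n) t v := by
  rw [Metric.cauchySeq_iff]
  intro ε hε
  obtain ⟨v', hv', hvv'⟩ := Metric.dense_iff.1 hD v (ε / 4) (by positivity)
  rw [Metric.mem_ball, dist_comm, dist_eq_norm] at hv'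
  obtain ⟨w, hw⟩ := hlim v' hvv'
  obtain ⟨N, hN⟩ := Metric.cauchySeq_iff.1 hw.cauchySeq (ε / (4 * (|t| + 1))) (by positivity)
  refine ⟨N, fun m hm n hn => ?_⟩
  have h1 : |t| * ‖X m v' - X n v'‖ ≤ ε / 4 := by
    have h2 := (hN m hm n hn).le
    rw [dist_eq_norm] at h2
    calc |t| * ‖X m v' - X n v'‖ ≤ (|t| + 1) * (ε / (4 * (|t| + 1))) := by gcongr; linarith
      _ = ε / 4 := by field_simp
  have h3 := norm_expGroup_apply_sub_le (hX m) (hX n) (hc m n) t v'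
  have e : expGroup (X m) t v - expGroup (X n) t v = expGroup (X m) t (v - v') +
      (expGroup (X m) t v' - expGroup (X n) t v') - expGroup (X n) t (v - v') := by
    simp only [map_sub]; abel
  rw [dist_eq_norm, e]
  refine lt_of_le_of_lt ((norm_sub_le _ _).trans (add_le_add_left (norm_add_le _ _) _)) ?_
  rw [norm_expGroup_apply (hX m), norm_expGroup_apply (hX n)]
  linarith

/-- If commuting bounded skew-adjoint operators `X n` converge strongly on a dense set, then the
unitary groups `exp (t X n)` converge strongly to a strongly continuous unitary group, whose
generator extends the limit of the `X n`. -/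
theorem exists_unitaryGroup_of_tendsto {X : ℕ → H →L[ℂ] H}
    (hX : ∀ n, X n ∈ skewAdjoint (H →L[ℂ] H)) (hc : ∀ m n, Commute (X m) (X n)) {D : Set H}
    (hD : Dense D) (hlim : ∀ v ∈ D, ∃ w, Tendsto (fun n => X n v) atTop (𝓝 w)) :
    ∃ U : ℝ → H →L[ℂ] H, U 0 = 1 ∧ (∀ s t, U (s + t) = U s * U t) ∧
      (∀ t, U t ∈ unitary (H →L[ℂ] H)) ∧ (∀ v, Continuous fun t => U t v) ∧
      ∀ v w, Tendsto (fun n => X n v) atTop (𝓝 w) → HasDerivAt (fun t => U t v) w 0 := by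
  have hconv : ∀ t, ∃ f : H → H, Tendsto (fun n v => expGroup (X n) t v) atTop (𝓝 f) := by
    intro t
    choose f hf using fun v => cauchySeq_tendsto_of_complete
      (cauchySeq_expGroup_apply hX hc hD hlim t v)
    exact ⟨f, tendsto_pi_nhds.2 hf⟩
  choose f hf using hconv
  let U : ℝ → H →L[ℂ] H := fun t => continuousLinearMapOfTendsto (fun n => expGroup (X n) t) (hf t)
  have hU : ∀ t v, Tendsto (fun n => expGroup (X n) t v) atTop (𝓝 (U t v)) := fun t v =>
    tendsto_pi_nhds.1 (hf t) v
  have hnorm : ∀ t v, ‖U t v‖ = ‖v‖ := fun t v =>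
    tendsto_nhds_unique (hU t v).norm (by simp only [norm_expGroup_apply (hX _), tendsto_const_nhds])
  have h0 : U 0 = 1 := by
    ext v
    refine tendsto_nhds_unique (hU 0 v) ?_
    simp only [expGroup_zero]
    exact tendsto_const_nhds
  have hadd : ∀ s t, U (s + t) = U s * U t := by
    intro s t
    ext v
    refine tendsto_nhds_unique (hU (s + t) v) ?_
    have h1 : Tendsto (fun n => expGroup (X n) s (expGroup (X n) t v - U t v)) atTop (𝓝 0) := by
      rw [tendsto_zero_iff_norm_tendsto_zero]
      simp only [norm_expGroup_apply (hX _)]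
      exact tendsto_iff_norm_sub_tendsto_zero.1 (hU t v)
    have h2 := h1.add (hU s (U t v))
    simp only [map_sub, sub_add_cancel, zero_add] at h2
    simp only [expGroup_add]
    exact h2
  -- A limit of unitaries is a priori only an isometry; the group law supplies the right inverse `U
  -- (-t)`.
  have hunit : ∀ t, U t ∈ unitary (H →L[ℂ] H) := by
    intro t
    have h1 : star (U t) * U t = 1 :=
      (ContinuousLinearMap.norm_map_iff_adjoint_comp_self (U t)).1 (hnorm t)
    have h2 : U t * U (-t) = 1 := by rw [← hadd, add_neg_cancel, h0]
    have h3 : star (U t) = U (-t) := left_inv_eq_right_inv h1 h2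
    exact Unitary.mem_iff.2 ⟨h1, by rw [h3, h2]⟩
  have hcontD : ∀ v ∈ D, Continuous fun t => U t v := by
    intro v hv
    obtain ⟨w, hw⟩ := hlim v hv
    have h1 : ∀ t, ‖U t v - v‖ ≤ |t| * ‖w‖ := fun t =>
      le_of_tendsto_of_tendsto' ((hU t v).sub_const v).norm (hw.norm.const_mul |t|)
        fun n => norm_expGroup_apply_sub_self_le (hX n) t v
    have h2 : LipschitzWith ‖w‖.toNNReal fun t => U t v := by
      refine LipschitzWith.of_dist_le_mul fun s t => ?_
      have e : U s v = U t (U (s - t) v) := by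
        have h3 := hadd t (s - t)
        rw [add_sub_cancel] at h3
        rw [h3]; rfl
      rw [Real.coe_toNNReal _ (norm_nonneg _), dist_eq_norm, e, ← map_sub, hnorm, mul_comm]
      exact h1 _
    exact h2.continuous
  have hcont : ∀ v, Continuous fun t => U t v := by
    intro v
    refine continuous_of_uniform_approx_of_continuous fun u hu => ?_
    obtain ⟨ε, hε, hεu⟩ := Metric.mem_uniformity_dist.1 hu
    obtain ⟨v', hv', hvv'⟩ := Metric.dense_iff.1 hD v ε hε
    refine ⟨fun t => U t v', hcontD v' hvv', fun t => hεu ?_⟩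
    rw [dist_eq_norm, ← map_sub, hnorm, ← dist_eq_norm, dist_comm]
    exact hv'
  refine ⟨U, h0, hadd, hunit, hcont, fun v w hw => ?_⟩
  obtain ⟨C, hC⟩ := hw.norm.bddAbove_range
  -- Derivatives do not pass to the limit, but the integrated equation does, by dominated
  -- convergence.
  have hint : ∀ t, U t v - v = ∫ s in (0 : ℝ)..t, U s w := by
    intro t
    refine tendsto_nhds_unique ((hU t v).sub_const v) ?_
    simp only [expGroup_apply_sub_self_eq_integral]
    refine intervalIntegral.tendsto_integral_filter_of_dominated_convergence (fun _ => C)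
      (Eventually.of_forall fun n => (continuous_expGroup_apply _ _).aestronglyMeasurable)
      (Eventually.of_forall fun n => Eventually.of_forall fun s _ => ?_)
      intervalIntegrable_const (Eventually.of_forall fun s _ => ?_)
    · rw [norm_expGroup_apply (hX n)]
      exact hC ⟨n, rfl⟩
    · have h1 : Tendsto (fun n => expGroup (X n) s (X n v - w)) atTop (𝓝 0) := by
        rw [tendsto_zero_iff_norm_tendsto_zero]
        simp only [norm_expGroup_apply (hX _)]
        exact tendsto_iff_norm_sub_tendsto_zero.1 hw
      simpa using h1.add (hU s w)
  have h1 : HasDerivAt (fun t => ∫ s in (0 : ℝ)..t, U s w) (U 0 w) 0 :=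
    intervalIntegral.integral_hasDerivAt_right ((hcont w).intervalIntegrable _ _)
      (hcont w).stronglyMeasurable.stronglyMeasurableAtFilter (hcont w).continuousAt
  have h2 : (fun t => U t v) = fun t => v + ∫ s in (0 : ℝ)..t, U s w := by
    funext t
    rw [← hint, add_sub_cancel]
  rw [h2]
  simpa [h0] using h1.const_add v

end Limit

/-! ### Resolvents of a self-adjoint operator and Stone's theorem. -/

section Stone

variable {H : Type*} [NormedAddCommGroup H] [InnerProductSpace ℂ H]

local notation "⟪" x ", " y "⟫" => inner ℂ x y

open Complex (I)

variable {A : H →ₗ.[ℂ] H}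

variable {R : ℝ → H →L[ℂ] H}

/-- `R l` is the resolvent `(A + i l)⁻¹`, for all real `l ≠ 0`. -/
structure IsResolventFamily (A : H →ₗ.[ℂ] H) (R : ℝ → H →L[ℂ] H) : Prop where
  mem_graph : ∀ {l : ℝ}, l ≠ 0 → ∀ h, (R l h, h - (I * l) • R l h) ∈ A.graph
  apply_add_smul : ∀ {l : ℝ}, l ≠ 0 → ∀ {x y}, (x, y) ∈ A.graph → R l (y + (I * l) • x) = x

namespace IsResolventFamily

/-- With `u = R m h` and `x = R l u`, the resolvent identity reads `R l h = u + i(m - l) x`. The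
right side is `(A + i m) x`, so `R m` sends it to `x`. -/
theorem commute (hR : IsResolventFamily A R) {l m : ℝ} (hl : l ≠ 0) (hm : m ≠ 0) :
    Commute (R l) (R m) := by
  ext h
  change R l (R m h) = R m (R l h)
  set u := R m h with hu
  set x := R l u with hx
  have h1 : (u, h - (I * m) • u) ∈ A.graph := hR.mem_graph hm h
  have h2 : (x, u - (I * l) • x) ∈ A.graph := hR.mem_graph hl u
  have h3 := A.graph.add_mem h1 (A.graph.smul_mem (I * m - I * l) h2)
  have h4 := hR.apply_add_smul hl h3
  have e : (h - (I * m) • u + (I * m - I * l) • (u - (I * l) • x)) +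
      (I * l) • (u + (I * m - I * l) • x) = h := by module
  have h5 : R l h = u + (I * m - I * l) • x := by
    conv_lhs => rw [← e]
    exact h4
  have e2 : u + (I * m - I * l) • x = (u - (I * l) • x) + (I * m) • x := by module
  rw [h5, e2, hR.apply_add_smul hm h2]

/-- The bounded approximations `-i n² A (A² + n²)⁻¹` of `-i A`. -/
noncomputable def yosida (R : ℝ → H →L[ℂ] H) (l : ℝ) : H →L[ℂ] H :=
  (-(I * (l ^ 2 / 2 : ℝ))) • (R l + R (-l))

theorem commute_yosida (hR : IsResolventFamily A R) {l m : ℝ} (hl : l ≠ 0) (hm : m ≠ 0) :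
    Commute (yosida R l) (yosida R m) := by
  have hl' := neg_ne_zero.2 hl
  have hm' := neg_ne_zero.2 hm
  exact (((hR.commute hl hm).add_right (hR.commute hl hm')).add_left
    ((hR.commute hl' hm).add_right (hR.commute hl' hm'))).smul_left _ |>.smul_right _

/-- On the domain of `A` the growing factor `l ^ 2` disappears: what remains are two terms of the
form `i l R l w`, each of which tends to `w`. -/
theorem yosida_apply (hR : IsResolventFamily A R) {l : ℝ} (hl : l ≠ 0) {v w : H}
    (h : (v, w) ∈ A.graph) :
    yosida R l v = (-(I / 2)) • ((I * l) • R l w + (I * (-l : ℝ)) • R (-l) w) := by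
  have h1 := hR.apply_add_smul hl h
  have h2 := hR.apply_add_smul (neg_ne_zero.2 hl) h
  rw [map_add, map_smul] at h1 h2
  have hl' : (l : ℂ) ≠ 0 := by exact_mod_cast hl
  have e1 : (I * l) • R l v = v - R l w := by
    conv_rhs => enter [1]; rw [← h1]
    abel
  have e2 : (I * (-l : ℝ)) • R (-l) v = v - R (-l) w := by
    conv_rhs => enter [1]; rw [← h2]
    abel
  have e3 : yosida R l v =
      (-(l / 2 : ℂ)) • ((I * l) • R l v - (I * (-l : ℝ)) • R (-l) v) := by
    simp only [yosida, smul_apply, add_apply]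
    push_cast
    module
  rw [e3, e1, e2]
  have hI : I * I = -1 := Complex.I_mul_I
  simp only [smul_sub, smul_add, smul_smul]
  have e4 : -(I / 2) * (I * (l : ℂ)) = l / 2 := by linear_combination (-(l / 2) : ℂ) * hI
  have e5 : -(I / 2) * (I * ((-l : ℝ) : ℂ)) = -(l / 2) := by
    push_cast; linear_combination ((l / 2) : ℂ) * hI
  rw [e4, e5]
  module

end IsResolventFamily

variable [CompleteSpace H]

/-- This is `A = A*` read on graphs. The reverse implication, membership from a symmetric pairing,
is where self-adjointness exceeds symmetry. -/
theorem _root_.IsSelfAdjoint.mem_graph_iff (hA : IsSelfAdjoint A) {x y : H} :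
    (x, y) ∈ A.graph ↔ ∀ a b, (a, b) ∈ A.graph → ⟪b, x⟫ = ⟪a, y⟫ := by
  have h := LinearPMap.adjoint_graph_eq_graph_adjoint hA.dense_domain
  rw [LinearPMap.isSelfAdjoint_def.1 hA] at h
  rw [h, Submodule.mem_adjoint_iff, ← h]
  simp only [sub_eq_zero]

theorem _root_.IsSelfAdjoint.inner_graph (hA : IsSelfAdjoint A) {x y a b : H}
    (hx : (x, y) ∈ A.graph) (ha : (a, b) ∈ A.graph) : ⟪b, x⟫ = ⟪a, y⟫ :=
  hA.mem_graph_iff.1 hx a b ha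

/-- The cross term vanishes because `⟪y, x⟫` is real by symmetry. -/
theorem _root_.IsSelfAdjoint.norm_sq_add_smul (hA : IsSelfAdjoint A) {x y : H}
    (hx : (x, y) ∈ A.graph) (l : ℝ) :
    ‖y + (I * l) • x‖ ^ 2 = ‖y‖ ^ 2 + l ^ 2 * ‖x‖ ^ 2 := by
  have h := hA.inner_graph hx hx
  have h1 : RCLike.re ⟪y, (I * l) • x⟫ = 0 := by
    have h2 : (starRingEnd ℂ) ⟪y, x⟫ = ⟪y, x⟫ := by rw [inner_conj_symm, h]
    have h3 : (⟪y, x⟫).im = 0 := Complex.conj_eq_iff_im.1 h2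
    rw [inner_smul_right]
    simp [h3]
  rw [@norm_add_sq ℂ, h1, norm_smul]
  simp [mul_pow]

/-- A self-adjoint operator has a bounded resolvent at every nonzero imaginary number. -/
theorem _root_.IsSelfAdjoint.exists_resolvent (hA : IsSelfAdjoint A) {l : ℝ} (hl : l ≠ 0) :
    ∃ R : H →L[ℂ] H, (∀ h, (R h, h - (I * l) • R h) ∈ A.graph) ∧
      ∀ x y, (x, y) ∈ A.graph → R (y + (I * l) • x) = x := by
  have hcl : IsClosed (A.graph : Set (H × H)) := hA.isClosed
  have : CompleteSpace A.graph := hcl.completeSpace_coe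
  -- On the closed graph, a Banach space, `A + i l` is a bounded operator. The norm identity bounds
  -- it below, so it is injective with closed range.
  let S : A.graph →L[ℂ] H :=
    (ContinuousLinearMap.snd ℂ H H + (I * l : ℂ) • ContinuousLinearMap.fst ℂ H H).comp
      A.graph.subtypeL
  have hS : ∀ p : A.graph, ‖S p‖ ^ 2 = ‖(p : H × H).2‖ ^ 2 + l ^ 2 * ‖(p : H × H).1‖ ^ 2 :=
    fun p => hA.norm_sq_add_smul p.2 l
  have hbd : ∀ p : A.graph, ‖p‖ ≤ (1 + 1 / |l|) * ‖S p‖ := by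
    intro p
    have hl' : 0 < |l| := abs_pos.2 hl
    have h1 : ‖(p : H × H).2‖ ≤ ‖S p‖ :=
      (sq_le_sq₀ (norm_nonneg _) (norm_nonneg _)).1
        (by rw [hS]; nlinarith [sq_nonneg (l * ‖(p : H × H).1‖)])
    have h2 : |l| * ‖(p : H × H).1‖ ≤ ‖S p‖ := by
      refine (sq_le_sq₀ (by positivity) (norm_nonneg _)).1 ?_
      rw [hS, mul_pow, sq_abs]
      nlinarith [sq_nonneg ‖(p : H × H).2‖]
    have h3 : ‖(p : H × H).1‖ ≤ 1 / |l| * ‖S p‖ := by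
      rw [one_div, inv_mul_eq_div, le_div_iff₀ hl', mul_comm]
      exact h2
    have h4 : 0 ≤ 1 / |l| * ‖S p‖ := by positivity
    change max ‖(p : H × H).1‖ ‖(p : H × H).2‖ ≤ _
    rw [max_le_iff]
    constructor <;> linarith [norm_nonneg (S p)]
  have hanti : AntilipschitzWith (1 + 1 / |l|).toNNReal S := by
    refine AddMonoidHomClass.antilipschitz_of_bound S fun p => ?_
    rw [Real.coe_toNNReal _ (by positivity)]
    exact hbd p
  have hker : S.ker = ⊥ := LinearMap.ker_eq_bot.2 hanti.injective
  have hclr : IsClosed (S.range : Set H) := hanti.isClosed_range S.uniformContinuous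
  have hran : S.range = ⊤ := by
    rw [← hclr.submodule_topologicalClosure_eq, Submodule.topologicalClosure_eq_top_iff,
      Submodule.eq_bot_iff]
    intro h hh
    -- A vector `h` orthogonal to the range is an eigenvector with the non-real eigenvalue `i l`;
    -- the norm identity at `-l` then forces `h = 0`.
    have h1 : ∀ x y, (x, y) ∈ A.graph → ⟪y, h⟫ = ⟪x, (I * l) • h⟫ := by
      intro x y hxy
      have h2 : ⟪y + (I * l) • x, h⟫ = 0 := hh _ ⟨⟨(x, y), hxy⟩, rfl⟩
      rw [inner_add_left, inner_smul_left] at h2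
      rw [inner_smul_right]
      simp only [map_mul, Complex.conj_I, Complex.conj_ofReal] at h2
      linear_combination h2
    have h3 : (h, (I * l) • h) ∈ A.graph := hA.mem_graph_iff.2 h1
    have h4 := hA.norm_sq_add_smul h3 (-l)
    have h5 : (I * l) • h + (I * ((-l : ℝ) : ℂ)) • h = 0 := by
      rw [← add_smul]; simp
    rw [h5, norm_zero, norm_smul] at h4
    simp only [norm_mul, Complex.norm_I, one_mul, Complex.norm_real, Real.norm_eq_abs, mul_pow,
      sq_abs, neg_sq] at h4
    have hl2 : 0 < l ^ 2 := by positivity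
    have h6 : ‖h‖ ^ 2 = 0 := by nlinarith [sq_nonneg ‖h‖]
    simpa using h6
  let e := ContinuousLinearEquiv.ofBijective S hker hran
  have hes : ∀ h, S (e.symm h) = h := fun h => e.apply_symm_apply h
  refine ⟨((ContinuousLinearMap.fst ℂ H H).comp A.graph.subtypeL).comp
    (e.symm : H →L[ℂ] A.graph), fun h => ?_,
    fun x y hxy => ?_⟩
  · have h1 : h - (I * l) • ((e.symm h : A.graph) : H × H).1 = ((e.symm h : A.graph) : H × H).2 :=
      sub_eq_iff_eq_add.2 (hes h).symm
    change (((e.symm h : A.graph) : H × H).1, h - (I * l) • ((e.symm h : A.graph) : H × H).1) ∈ _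
    rw [h1]
    exact (e.symm h).2
  · have h1 : e.symm (y + (I * l) • x) = ⟨(x, y), hxy⟩ := by
      rw [ContinuousLinearEquiv.symm_apply_eq]
      rfl
    change ((e.symm (y + (I * l) • x) : A.graph) : H × H).1 = x
    rw [h1]

namespace IsResolventFamily

theorem norm_smul_apply_le (hR : IsResolventFamily A R) (hA : IsSelfAdjoint A) {l : ℝ}
    (hl : l ≠ 0) (h : H) : |l| * ‖R l h‖ ≤ ‖h‖ := by
  have h1 := hA.norm_sq_add_smul (hR.mem_graph hl h) l
  rw [sub_add_cancel] at h1
  refine (sq_le_sq₀ (by positivity) (norm_nonneg _)).1 ?_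
  rw [h1, mul_pow, sq_abs]
  nlinarith [sq_nonneg ‖h - (I * l) • R l h‖]

theorem star_eq (hR : IsResolventFamily A R) (hA : IsSelfAdjoint A) {l : ℝ} (hl : l ≠ 0) :
    star (R l) = R (-l) := by
  refine ((ContinuousLinearMap.eq_adjoint_iff _ _).2 fun k h => ?_).symm
  have h1 := hA.inner_graph (hR.mem_graph hl h) (hR.mem_graph (neg_ne_zero.2 hl) k)
  simp only [inner_sub_left, inner_sub_right, inner_smul_left, inner_smul_right, map_mul,
    Complex.conj_I, Complex.conj_ofReal] at h1
  push_cast at h1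
  linear_combination -h1

/-- For `w'` in the domain, `w' - i l R l w' = R l (A w')` is `O(1/|l|)`. The bound `‖i l R l‖ ≤ 1`
extends the limit from the dense domain to all `w`. -/
theorem tendsto_smul_apply (hR : IsResolventFamily A R) (hA : IsSelfAdjoint A) {l : ℕ → ℝ}
    (hl : ∀ n, l n ≠ 0) (hlim : Tendsto (fun n => |l n|) atTop atTop) (w : H) :
    Tendsto (fun n => (I * l n) • R (l n) w) atTop (𝓝 w) := by
  rw [Metric.tendsto_atTop]
  intro ε hε
  obtain ⟨w', hw', hww'⟩ := Metric.dense_iff.1 hA.dense_domain w (ε / 4) (by positivity)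
  rw [Metric.mem_ball, dist_comm, dist_eq_norm] at hw'
  have hg : (w', A ⟨w', hww'⟩) ∈ A.graph := A.mem_graph ⟨w', hww'⟩
  set z := A ⟨w', hww'⟩
  obtain ⟨N, hN⟩ := eventually_atTop.1 (hlim.eventually_gt_atTop (4 * ‖z‖ / ε))
  refine ⟨N, fun n hn => ?_⟩
  have hln : 0 < |l n| := abs_pos.2 (hl n)
  have hb : ∀ v, ‖(I * l n) • R (l n) v‖ ≤ ‖v‖ := fun v => by
    rw [norm_smul]
    simpa using hR.norm_smul_apply_le hA (hl n) v
  have h1 : w' - (I * l n) • R (l n) w' = R (l n) z := by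
    have h2 := hR.apply_add_smul (hl n) hg
    rw [map_add, map_smul] at h2
    conv_lhs => enter [1]; rw [← h2]
    abel
  have h3 : ‖R (l n) z‖ < ε / 4 := by
    have h4 := hR.norm_smul_apply_le hA (hl n) z
    have h5 := hN n hn
    rw [div_lt_iff₀ hε] at h5
    by_contra! h6
    have := mul_le_mul_of_nonneg_left h6 hln.le
    linarith
  have e : (I * l n) • R (l n) w - w =
      (I * l n) • R (l n) (w - w') - (w - w') - R (l n) z := by
    rw [← h1, map_sub, smul_sub]; abel
  rw [dist_eq_norm, e]
  refine lt_of_le_of_lt ((norm_sub_le _ _).trans (add_le_add_left (norm_sub_le _ _) _)) ?_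
  have := hb (w - w')
  linarith

theorem yosida_mem_skewAdjoint (hR : IsResolventFamily A R) (hA : IsSelfAdjoint A) {l : ℝ}
    (hl : l ≠ 0) : yosida R l ∈ skewAdjoint (H →L[ℂ] H) := by
  rw [skewAdjoint.mem_iff, yosida, star_smul, star_add, hR.star_eq hA hl,
    hR.star_eq hA (neg_ne_zero.2 hl), neg_neg, add_comm (R (-l)), ← neg_smul]
  congr 1
  simp

theorem tendsto_yosida_apply (hR : IsResolventFamily A R) (hA : IsSelfAdjoint A) {l : ℕ → ℝ}
    (hl : ∀ n, l n ≠ 0) (hlim : Tendsto (fun n => |l n|) atTop atTop) {v w : H}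
    (h : (v, w) ∈ A.graph) :
    Tendsto (fun n => yosida R (l n) v) atTop (𝓝 (-(I • w))) := by
  have h1 := (hR.tendsto_smul_apply hA hl hlim w).add
    (hR.tendsto_smul_apply hA (l := fun n => -l n) (fun n => neg_ne_zero.2 (hl n))
      (by simpa using hlim) w)
  have h2 := h1.const_smul (-(I / 2))
  have e : (-(I / 2)) • (w + w) = -(I • w) := by module
  rw [e] at h2
  exact h2.congr fun n => (hR.yosida_apply (hl n) h).symm

end IsResolventFamily

/-- **Stone's theorem**: a self-adjoint operator generates a strongly continuous unitary group. -/
theorem exists_isUnitaryGroupGeneratedBy (hA : IsSelfAdjoint A) :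
    ∃ U : ℝ → H →L[ℂ] H, IsUnitaryGroupGeneratedBy A U := by
  have hres : ∀ l : ℝ, ∃ R : H →L[ℂ] H, l ≠ 0 → (∀ h, (R h, h - (I * l) • R h) ∈ A.graph) ∧
      ∀ x y, (x, y) ∈ A.graph → R (y + (I * l) • x) = x := by
    intro l
    by_cases hl : l = 0
    · exact ⟨0, fun h => absurd hl h⟩
    · obtain ⟨R, hR⟩ := hA.exists_resolvent hl
      exact ⟨R, fun _ => hR⟩
  choose R hR using hres
  replace hR : IsResolventFamily A R :=
    ⟨fun hl => (hR _ hl).1, fun hl _ _ h => (hR _ hl).2 _ _ h⟩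
  let l : ℕ → ℝ := fun n => n + 1
  have hl : ∀ n, l n ≠ 0 := fun n => by positivity
  have hlim : Tendsto (fun n => |l n|) atTop atTop :=
    tendsto_abs_atTop_atTop.comp
      (tendsto_atTop_add_const_right _ _ tendsto_natCast_atTop_atTop)
  obtain ⟨U, h0, hadd, hunit, hcont, hderiv⟩ := exists_unitaryGroup_of_tendsto
    (fun n => hR.yosida_mem_skewAdjoint hA (hl n)) (fun m n => hR.commute_yosida (hl m) (hl n))
    hA.dense_domain fun v hv => ⟨_, hR.tendsto_yosida_apply hA hl hlim (A.mem_graph ⟨v, hv⟩)⟩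
  have hgen : ∀ {v w : H}, (v, w) ∈ A.graph → HasDerivAt (fun t : ℝ => U t v) (-(I • w)) 0 :=
    fun h => hderiv _ _ (hR.tendsto_yosida_apply hA hl hlim h)
  refine ⟨U, h0, hadd, hunit, hcont, fun v w => ⟨hgen, fun h => hA.mem_graph_iff.2 ?_⟩⟩
  -- `A` has no proper symmetric extension: differentiating the constant `⟪U t a, U t v⟫` at 0
  -- yields the pairing that puts `(v, w)` in its graph.
  intro a b hab
  have h1 := (hgen hab).inner ℂ h
  have e : (fun t : ℝ => ⟪U t a, U t v⟫) = fun _ => ⟪a, v⟫ := by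
    funext t
    exact ContinuousLinearMap.inner_map_map_of_mem_unitary (hunit t) a v
  rw [e] at h1
  have h2 := h1.unique (hasDerivAt_const _ _)
  simp only [h0, one_apply_eq_self, inner_neg_left, inner_neg_right, inner_smul_left,
    inner_smul_right, Complex.conj_I] at h2
  have h3 : I * (⟪b, v⟫ - ⟪a, w⟫) = 0 := by linear_combination h2
  exact sub_eq_zero.1 ((mul_eq_zero.1 h3).resolve_left Complex.I_ne_zero)

theorem isUnitaryGroupGeneratedBy_unitaryGroup (hA : IsSelfAdjoint A) :
    IsUnitaryGroupGeneratedBy A (unitaryGroup A) := by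
  have h := exists_isUnitaryGroupGeneratedBy hA
  rw [unitaryGroup, dif_pos h]
  exact h.choose_spec

end Stone

/-! ### Mild solutions: interaction picture and uniqueness. -/

section MildSolutions

variable {H : Type*} [NormedAddCommGroup H] [InnerProductSpace ℂ H] [CompleteSpace H]

open Complex (I)

namespace IsUnitaryGroupGeneratedBy

variable {A : H →ₗ.[ℂ] H} {U : ℝ → H →L[ℂ] H}

theorem sub_apply (hU : IsUnitaryGroupGeneratedBy A U) (s t : ℝ) (v : H) :
    U (s - t) v = U s (U (-t) v) := by
  rw [sub_eq_add_neg, hU.map_add]; rfl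

theorem apply_neg_apply (hU : IsUnitaryGroupGeneratedBy A U) (t : ℝ) (v : H) :
    U t (U (-t) v) = v := by
  rw [← hU.sub_apply, sub_self, hU.map_zero]; rfl

theorem neg_apply_apply (hU : IsUnitaryGroupGeneratedBy A U) (t : ℝ) (v : H) :
    U (-t) (U t v) = v := by
  simpa using hU.apply_neg_apply (-t) v

/-- Strong continuity becomes joint continuity because every `U t` is an isometry. -/
theorem continuous_uncurry (hU : IsUnitaryGroupGeneratedBy A U) :
    Continuous fun q : ℝ × H => U q.1 q.2 := by
  rw [continuous_iff_continuousAt]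
  rintro ⟨t₀, v₀⟩
  rw [ContinuousAt, tendsto_iff_norm_sub_tendsto_zero]
  have h1 : Tendsto (fun q : ℝ × H => ‖q.2 - v₀‖ + ‖U q.1 v₀ - U t₀ v₀‖) (𝓝 (t₀, v₀)) (𝓝 0) := by
    have h2 : Continuous fun q : ℝ × H => ‖q.2 - v₀‖ + ‖U q.1 v₀ - U t₀ v₀‖ := by
      have := (hU.strongly_continuous v₀).comp (continuous_fst (X := ℝ) (Y := H))
      exact (by fun_prop : Continuous fun q : ℝ × H => ‖q.2 - v₀‖).add
        (this.sub continuous_const).norm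
    simpa using h2.tendsto (t₀, v₀)
  refine squeeze_zero (fun _ => norm_nonneg _) (fun q => ?_) h1
  have e : U q.1 q.2 - U t₀ v₀ = U q.1 (q.2 - v₀) + (U q.1 v₀ - U t₀ v₀) := by
    rw [map_sub]; abel
  rw [e]
  refine (norm_add_le _ _).trans ?_
  rw [hU.norm_apply]

theorem continuous_apply {X : Type*} [TopologicalSpace X] (hU : IsUnitaryGroupGeneratedBy A U)
    {a : X → ℝ} {f : X → H} (ha : Continuous a) (hf : Continuous f) :
    Continuous fun x => U (a x) (f x) :=
  hU.continuous_uncurry.comp (ha.prodMk hf)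

theorem continuousOn_apply {X : Type*} [TopologicalSpace X] {s : Set X}
    (hU : IsUnitaryGroupGeneratedBy A U) {a : X → ℝ} {f : X → H} (ha : ContinuousOn a s)
    (hf : ContinuousOn f s) : ContinuousOn (fun x => U (a x) (f x)) s :=
  hU.continuous_uncurry.comp_continuousOn (ha.prodMk hf)

end IsUnitaryGroupGeneratedBy

theorem _root_.MeasureTheory.LocallyIntegrable.continuous_primitive {γ : ℝ → ℝ}
    (hγ : LocallyIntegrable γ) : Continuous fun t => ∫ s in (0 : ℝ)..t, γ s :=
  intervalIntegral.continuous_primitive (fun _ _ => hγ.intervalIntegrable) 0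

variable {A : H →ₗ.[ℂ] H} {B : H → H} {α β : ℝ → ℝ} {u₀ : H} {T : ℝ} {w : ℝ → H}

theorem IsSolutionOn.mono (h : IsSolutionOn A B α β u₀ T w) {T' : ℝ} (hT : T' ≤ T) :
    IsSolutionOn A B α β u₀ T' w :=
  ⟨h.1.mono (Icc_subset_Icc_right hT), fun t ht => h.2 t (Icc_subset_Icc_right hT ht)⟩

theorem IsSolutionOn.congr (h : IsSolutionOn A B α β u₀ T w) {v : ℝ → H}
    (hv : EqOn v w (Icc 0 T)) : IsSolutionOn A B α β u₀ T v := by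
  refine ⟨h.1.congr hv, fun t ht => ?_⟩
  rw [hv ht, h.2 t ht]
  congr 2
  refine intervalIntegral.integral_congr fun s hs => ?_
  rw [uIcc_of_le ht.1] at hs
  simp only [hv ⟨hs.1, hs.2.trans ht.2⟩]

/-- Duhamel's formula in the interaction picture. -/
theorem isSolutionOn_iff (hA : IsSelfAdjoint A) (hB : Continuous B) (hα : LocallyIntegrable α)
    (hβ : LocallyIntegrable β) :
    IsSolutionOn A B α β u₀ T w ↔ ContinuousOn w (Icc 0 T) ∧ ∀ t ∈ Icc 0 T,
      unitaryGroup A (-∫ r in (0 : ℝ)..t, α r) (w t) = u₀ + ∫ s in (0 : ℝ)..t,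
        β s • -(I • unitaryGroup A (-∫ r in (0 : ℝ)..s, α r) (B (w s))) := by
  have hU := isUnitaryGroupGeneratedBy_unitaryGroup hA
  refine and_congr_right fun hw => forall₂_congr fun t ht => ?_
  set U := unitaryGroup A with hUdef
  set a : ℝ → ℝ := fun t => ∫ r in (0 : ℝ)..t, α r with ha
  have hac : Continuous a := hα.continuous_primitive
  -- This splitting lets `U (a t)` be pulled out of the Duhamel integral and inverted.
  have hprop : ∀ s v, propagator A α t s v = U (a t) (U (-a s) v) := by
    intro s v
    rw [propagator, ← intervalIntegral.integral_interval_sub_left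
      (hα.intervalIntegrable (a := 0)) hα.intervalIntegrable, ← hU.sub_apply]
  have hint : IntervalIntegrable (fun s => β s • U (-a s) (B (w s))) volume 0 t := by
    refine hβ.intervalIntegrable.smul_continuousOn ?_
    rw [uIcc_of_le ht.1]
    exact hU.continuousOn_apply hac.neg.continuousOn
      (hB.comp_continuousOn (hw.mono (Icc_subset_Icc_right ht.2)))
  have e1 : (∫ s in (0 : ℝ)..t, (β s : ℂ) • propagator A α t s (B (w s))) =
      U (a t) (∫ s in (0 : ℝ)..t, β s • U (-a s) (B (w s))) := by
    rw [← ContinuousLinearMap.intervalIntegral_comp_comm _ hint]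
    refine intervalIntegral.integral_congr fun s _ => ?_
    simp only [hprop, Complex.coe_smul]
    rw [← Complex.coe_smul, ← Complex.coe_smul, map_smul]
  have e2 : (∫ s in (0 : ℝ)..t, β s • -(I • U (-a s) (B (w s)))) =
      -(I • ∫ s in (0 : ℝ)..t, β s • U (-a s) (B (w s))) := by
    rw [← intervalIntegral.integral_smul, ← intervalIntegral.integral_neg]
    refine intervalIntegral.integral_congr fun s _ => ?_
    simp only [smul_neg, smul_comm (β s) I]
  have e3 : propagator A α t 0 u₀ = U (a t) u₀ := by
    rw [hprop]; simp [ha, hU.map_zero]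
  rw [e1, e2, e3, ← map_smul, ← map_sub, ← sub_eq_add_neg]
  constructor
  · intro h
    change U (-a t) (w t) = _
    rw [h, hU.neg_apply_apply]
  · intro h
    rw [← h]
    exact (hU.apply_neg_apply _ _).symm

/-- `B` is Lipschitz on the compact union of the two trajectories, so Gronwall applies with zero
initial error. -/
theorem IsSolutionOn.eqOn (hA : IsSelfAdjoint A) (hB : LocallyLipschitz B)
    (hα : LocallyIntegrable α) (hβ : LocallyIntegrable β) {v : ℝ → H}
    (hv : IsSolutionOn A B α β u₀ T v) (hw : IsSolutionOn A B α β u₀ T w) :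
    EqOn v w (Icc 0 T) := by
  have hU := isUnitaryGroupGeneratedBy_unitaryGroup hA
  have hBc := hB.continuous
  rw [isSolutionOn_iff hA hBc hα hβ] at hv hw
  obtain ⟨L, hL⟩ := (hB.locallyLipschitzOn (s := v '' Icc 0 T ∪ w '' Icc 0 T)
    ).exists_lipschitzOnWith_of_compact
    ((isCompact_Icc.image_of_continuousOn hv.1).union (isCompact_Icc.image_of_continuousOn hw.1))
  have hac : Continuous fun t => ∫ r in (0 : ℝ)..t, α r := hα.continuous_primitive
  have hint : ∀ {z : ℝ → H}, ContinuousOn z (Icc 0 T) → ∀ t ∈ Icc 0 T, IntervalIntegrable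
      (fun s => β s • -(I • unitaryGroup A (-∫ r in (0 : ℝ)..s, α r) (B (z s)))) volume 0 t := by
    intro z hz t ht
    refine hβ.intervalIntegrable.smul_continuousOn ?_
    rw [uIcc_of_le ht.1]
    exact ((hU.continuousOn_apply hac.neg.continuousOn
      (hBc.comp_continuousOn (hz.mono (Icc_subset_Icc_right ht.2)))).const_smul I).neg
  have hκ := hβ.const_mul_abs L
  have hle := le_of_le_add_integral_mul hκ (fun s => by positivity)
    (h := fun t => ‖v t - w t‖) (hv.1.sub hw.1).norm le_rfl (fun t ht => by
      rw [zero_add, ← hU.norm_apply (-∫ r in (0 : ℝ)..t, α r), map_sub, hv.2 t ht, hw.2 t ht,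
        add_sub_add_left_eq_sub, ← intervalIntegral.integral_sub (hint hv.1 t ht) (hint hw.1 t ht)]
      refine intervalIntegral.norm_integral_le_of_norm_le ht.1 (Eventually.of_forall fun s hs => ?_)
        (hκ.intervalIntegrable.mul_continuousOn ?_)
      · have hs' : s ∈ Icc 0 T := ⟨hs.1.le, hs.2.trans ht.2⟩
        rw [← smul_sub, neg_sub_neg, ← smul_sub, ← map_sub, norm_smul, norm_smul, hU.norm_apply,
          Complex.norm_I, one_mul, Real.norm_eq_abs, norm_sub_rev, mul_comm (L : ℝ), mul_assoc]
        gcongr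
        exact hL.norm_sub_le (Or.inl ⟨s, hs', rfl⟩) (Or.inr ⟨s, hs', rfl⟩)
      · rw [uIcc_of_le ht.1]
        exact ((hv.1.sub hw.1).mono (Icc_subset_Icc_right ht.2)).norm)
  intro t ht
  have h := hle t ht
  simp only [mul_zero, zero_mul] at h
  exact sub_eq_zero.1 (norm_le_zero_iff.1 h)

/-- `flow` chooses a solution separately for each time; uniqueness makes the choices agree. -/
theorem IsSolutionOn.eqOn_flow (hA : IsSelfAdjoint A) (hB : LocallyLipschitz B)
    (hα : LocallyIntegrable α) (hβ : LocallyIntegrable β) (hw : IsSolutionOn A B α β u₀ T w) :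
    EqOn (flow A B α β u₀) w (Icc 0 T) := by
  intro t ht
  have h : ∃ w, IsSolutionOn A B α β u₀ t w := ⟨w, hw.mono ht.2⟩
  rw [flow, dif_pos h]
  exact h.choose_spec.eqOn hA hB hα hβ (hw.mono ht.2) ⟨ht.1, le_rfl⟩

theorem IsSolutionOn.isUniqueSolutionOn_flow (hA : IsSelfAdjoint A) (hB : LocallyLipschitz B)
    (hα : LocallyIntegrable α) (hβ : LocallyIntegrable β) (hw : IsSolutionOn A B α β u₀ T w) :
    IsUniqueSolutionOn A B α β u₀ T (flow A B α β u₀) := by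
  have h := hw.congr (hw.eqOn_flow hA hB hα hβ)
  exact ⟨h, fun v hv => hv.eqOn hA hB hα hβ h⟩

end MildSolutions

/-! ### Convergence of the approximating problems. -/

section Convergence

variable {H : Type*} [NormedAddCommGroup H] [InnerProductSpace ℂ H] [CompleteSpace H]

open Complex (I)

variable {A : H →ₗ.[ℂ] H} {B : H → H} {u₀ : H}

theorem exists_interaction_picture_solution {α β : ℝ → ℝ} (hA : IsSelfAdjoint A)
    {F : ℝ → H → H} (hF : Continuous (Function.uncurry F)) {L : NNReal}
    (hL : ∀ s, LipschitzWith L (F s)) (hα : LocallyIntegrable α) (hβ : LocallyIntegrable β)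
    (u₀ : H) {T : ℝ} (hT : 0 ≤ T) :
    ∃ w : ℝ → H, Continuous w ∧ ∀ t ∈ Icc 0 T,
      unitaryGroup A (-∫ r in (0 : ℝ)..t, α r) (w t) = u₀ + ∫ s in (0 : ℝ)..t,
        β s • -(I • unitaryGroup A (-∫ r in (0 : ℝ)..s, α r) (F s (w s))) := by
  have hU := isUnitaryGroupGeneratedBy_unitaryGroup hA
  have hac := hα.continuous_primitive
  set a : ℝ → ℝ := fun t => ∫ r in (0 : ℝ)..t, α r
  obtain ⟨v, hv, hveq⟩ := exists_eq_add_integral_smul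
    (g := fun s x => -(I • unitaryGroup A (-a s) (F s (unitaryGroup A (a s) x))))
    ((hU.continuous_apply (hac.comp continuous_fst).neg (hF.comp (continuous_fst.prodMk
      (hU.continuous_apply (hac.comp continuous_fst) continuous_snd)))).const_smul I).neg
    (L := L) (fun s => LipschitzWith.of_dist_le_mul fun x y => by
      rw [dist_neg_neg, dist_smul₀, Complex.norm_I, one_mul, dist_eq_norm, ← map_sub,
        hU.norm_apply, ← dist_eq_norm]
      refine ((hL s).dist_le_mul _ _).trans_eq ?_
      rw [dist_eq_norm, ← map_sub, hU.norm_apply, ← dist_eq_norm]) hβ u₀ hT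
  refine ⟨fun t => unitaryGroup A (a t) (v t), hU.continuous_apply hac hv, fun t ht => ?_⟩
  change unitaryGroup A (-a t) _ = _
  rw [hU.neg_apply_apply, hveq t ht]

variable {α β : ℕ → ℝ → ℝ} {αbar βbar : ℝ → ℝ} {S : ℝ}

/-- Weak convergence of the dominated coefficients makes the primitives converge uniformly. -/
theorem WeaklyConvergesTo.tendstoUniformlyOn_primitive (hα : ∀ n, LocallyIntegrable (α n))
    (hαbar : LocallyIntegrable αbar) (hαw : WeaklyConvergesTo α (fun _ => 1))
    (hαdom : ∀ n, ∀ᵐ t, |α n t| ≤ αbar t) (S : ℝ) :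
    TendstoUniformlyOn (fun n t => ∫ s in (0 : ℝ)..t, α n s) (fun t => t) atTop (Icc 0 S) := by
  refine AbstractSplitting.tendstoUniformlyOn_primitive hα hαbar hαdom continuous_id
    fun t ht => ?_
  simpa using hαw 0 t ht.1 (fun _ => 1) continuousOn_const

/-- Write `β n • y n - x = β n • (y n - x) + (β n - 1) • x`: domination handles the first term, weak
convergence the second. -/
theorem tendstoUniformlyOn_integral_smul_sub {E : Type*} [NormedAddCommGroup E] [NormedSpace ℝ E]
    [CompleteSpace E] (hβ : ∀ n, LocallyIntegrable (β n)) (hβbar : LocallyIntegrable βbar)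
    (hβw : WeaklyConvergesTo β (fun _ => 1)) (hβdom : ∀ n, ∀ᵐ t, |β n t| ≤ βbar t) {x : ℝ → E}
    {y : ℕ → ℝ → E} (hx : Continuous x) (hy : ∀ n, Continuous (y n))
    (hyx : TendstoUniformlyOn y x atTop (Icc 0 S)) :
    TendstoUniformlyOn (fun n t => (∫ s in (0 : ℝ)..t, β n s • y n s) - ∫ s in (0 : ℝ)..t, x s)
      (fun _ => 0) atTop (Icc 0 S) := by
  rcases lt_or_ge S 0 with hS | hS
  · rw [Icc_eq_empty (not_le.2 hS)]
    exact tendstoUniformlyOn_empty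
  have h1 : LocallyIntegrable (fun _ : ℝ => (1 : ℝ)) := continuous_const.locallyIntegrable
  have hprim := hβw.tendstoUniformlyOn_primitive hβ hβbar hβdom S
  have hlim : TendstoUniformlyOn (fun n t => ∫ s in (0 : ℝ)..t, (β n s - 1)) (fun _ => 0) atTop
      (Icc 0 S) := by
    rw [Metric.tendstoUniformlyOn_iff] at hprim ⊢
    refine fun ε hε => (hprim ε hε).mono fun n hn t ht => ?_
    rw [intervalIntegral.integral_sub (hβ n).intervalIntegrable h1.intervalIntegrable, dist_comm,
      dist_zero_right]
    have := hn t ht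
    rw [dist_comm, dist_eq_norm] at this
    simpa using this
  have hstep := tendstoUniformlyOn_integral_smul (γ := fun n s => β n s - 1)
    (γbar := fun s => βbar s + 1) (fun n => (hβ n).sub h1) (hβbar.add h1)
    (fun n => (hβdom n).mono fun t ht => (abs_sub _ _).trans (by simpa using ht)) hx hlim
  set J := ∫ s in (0 : ℝ)..S, |βbar s| with hJ
  have hβa : LocallyIntegrable fun s => |βbar s| := by simpa using hβbar.const_mul_abs 1
  have hJ0 : 0 ≤ J := intervalIntegral.integral_nonneg hS fun _ _ => abs_nonneg _
  rw [Metric.tendstoUniformlyOn_iff] at hstep hyx ⊢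
  intro ε hε
  filter_upwards [hstep (ε / 2) (by positivity), hyx (ε / (2 * (J + 1))) (by positivity)]
    with n hn1 hn2 t ht
  have hn1' := hn1 t ht
  rw [dist_zero_left] at hn1' ⊢
  have hβi : ∀ {z : ℝ → E}, Continuous z → IntervalIntegrable (fun s => β n s • z s) volume 0 t :=
    fun hz => (hβ n).intervalIntegrable.smul_continuousOn hz.continuousOn
  have e : (∫ s in (0 : ℝ)..t, β n s • y n s) - ∫ s in (0 : ℝ)..t, x s =
      (∫ s in (0 : ℝ)..t, β n s • (y n s - x s)) + ∫ s in (0 : ℝ)..t, (β n s - 1) • x s := by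
    simp only [smul_sub, sub_smul, one_smul]
    rw [intervalIntegral.integral_sub (hβi (hy n)) (hβi hx),
      intervalIntegral.integral_sub (hβi hx) (hx.intervalIntegrable _ _)]
    abel
  have h2 : ‖∫ s in (0 : ℝ)..t, β n s • (y n s - x s)‖ ≤ ε / (2 * (J + 1)) * J := by
    calc ‖∫ s in (0 : ℝ)..t, β n s • (y n s - x s)‖
        ≤ ∫ s in (0 : ℝ)..t, ε / (2 * (J + 1)) * |βbar s| := by
          refine intervalIntegral.norm_integral_le_of_norm_le ht.1 ?_
            (hβa.intervalIntegrable.const_mul _)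
          filter_upwards [hβdom n] with s hs hsI
          have h3 := hn2 s ⟨hsI.1.le, hsI.2.trans ht.2⟩
          rw [dist_comm, dist_eq_norm] at h3
          rw [norm_smul, mul_comm]
          exact mul_le_mul h3.le (hs.trans (le_abs_self _)) (norm_nonneg _) (by positivity)
      _ ≤ ε / (2 * (J + 1)) * J := by
          rw [intervalIntegral.integral_const_mul]
          gcongr
          exact primitive_mono hβa (fun _ => abs_nonneg _) ht.2
  have h3 : ε / (2 * (J + 1)) * J ≤ ε / 2 := by
    rw [div_mul_eq_mul_div, div_le_div_iff₀ (by positivity) (by positivity)]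
    nlinarith
  rw [e]
  refine (norm_add_le _ _).trans_lt ?_
  linarith

/-- Near a solution of the limit problem there are solutions of the approximating problems. -/
theorem eventually_exists_isSolutionOn (hA : IsSelfAdjoint A) (hB : LocallyLipschitz B)
    (hα : ∀ n, LocallyIntegrable (α n)) (hβ : ∀ n, LocallyIntegrable (β n))
    (hαbar : LocallyIntegrable αbar) (hβbar : LocallyIntegrable βbar)
    (hαw : WeaklyConvergesTo α (fun _ => 1)) (hβw : WeaklyConvergesTo β (fun _ => 1))
    (hαdom : ∀ n, ∀ᵐ t, |α n t| ≤ αbar t) (hβdom : ∀ n, ∀ᵐ t, |β n t| ≤ βbar t)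
    (hS : 0 ≤ S) {u : ℝ → H} (hu : IsSolutionOn A B (fun _ => 1) (fun _ => 1) u₀ S u)
    {ε : ℝ} (hε : 0 < ε) :
    ∀ᶠ n in atTop, ∃ w, IsSolutionOn A B (α n) (β n) u₀ S w ∧ ∀ t ∈ Icc 0 S, ‖w t - u t‖ ≤ ε := by
  -- Extending `u` by its endpoint values makes it continuous on the line without enlarging its
  -- compact trajectory.
  wlog huc : Continuous u ∧ IsCompact (range u) generalizing u
  · have hr : Continuous ((Icc 0 S).domRestrict u) := hu.1.domRestrict
    have he : EqOn (IccExtend hS ((Icc 0 S).domRestrict u)) u (Icc 0 S) := fun t ht =>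
      IccExtend_of_mem hS _ ht
    refine (this (hu.congr he) ⟨hr.Icc_extend', ?_⟩).mono fun n => ?_
    · rw [IccExtend_range]
      exact isCompact_range hr
    · rintro ⟨w, hw, hwu⟩
      exact ⟨w, hw, fun t ht => by rw [← he ht]; exact hwu t ht⟩
  obtain ⟨huc, hK⟩ := huc
  have hU := isUnitaryGroupGeneratedBy_unitaryGroup hA
  have hBc := hB.continuous
  have h1 : LocallyIntegrable (fun _ : ℝ => (1 : ℝ)) := continuous_const.locallyIntegrable
  obtain ⟨δ, hδ, L, hL⟩ := hB.exists_lipschitzOnWith_closedBall hK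
  -- Truncation to the tube of radius `δ` around `u`: globally Lipschitz in `y`, and equal to `B`
  -- inside the tube.
  let F : ℝ → H → H := fun s y => B (u s + radialRetraction δ (y - u s))
  have hmem : ∀ s y, u s + radialRetraction δ (y - u s) ∈ Metric.closedBall (u s) δ :=
    fun s y => by simpa using norm_radialRetraction_le hδ (y - u s)
  have hF : Continuous (Function.uncurry F) := by
    have := (lipschitzWith_radialRetraction (E := H) hδ).continuous
    exact hBc.comp (by fun_prop)
  have hFL : ∀ s, LipschitzWith (L * 2) (F s) := fun s => LipschitzWith.of_dist_le_mul fun x y => by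
    refine ((hL (u s) ⟨s, rfl⟩).dist_le_mul _ (hmem s x) _ (hmem s y)).trans ?_
    rw [dist_add_left, NNReal.coe_mul, mul_assoc]
    gcongr
    refine ((lipschitzWith_radialRetraction hδ).dist_le_mul _ _).trans_eq ?_
    rw [dist_sub_right]
  have hFu : ∀ s, F s (u s) = B (u s) := fun s => by
    simp [F, radialRetraction_of_norm_le hδ (z := (0 : H)) (by simpa using hδ.le)]
  let a : ℕ → ℝ → ℝ := fun n t => ∫ r in (0 : ℝ)..t, α n r
  have hac : ∀ n, Continuous (a n) := fun n => (hα n).continuous_primitive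
  have ha : TendstoUniformlyOn a (fun t => t) atTop (Icc 0 S) :=
    hαw.tendstoUniformlyOn_primitive hα hαbar hαdom S
  have hfc : Continuous fun s => B (u s) := hBc.comp huc
  let q : ℝ → ℝ → H := fun r s => -(I • unitaryGroup A (-r) (B (u s)))
  have hq : Continuous (Function.uncurry q) :=
    ((hU.continuous_apply continuous_fst.neg (hfc.comp continuous_snd)).const_smul I).neg
  let p : ℝ → H := fun t => unitaryGroup A (-t) (u t)
  have hpc : Continuous p := hU.continuous_apply continuous_neg huc
  have hp : ∀ t ∈ Icc 0 S, p t = u₀ + ∫ s in (0 : ℝ)..t, q s s := by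
    intro t ht
    simpa [p, q] using ((isSolutionOn_iff hA hBc h1 h1).1 hu).2 t ht
  have hR1 : TendstoUniformlyOn (fun n t => p t - unitaryGroup A (t - a n t) (p t)) (fun _ => 0)
      atTop (Icc 0 S) := by
    have := tendstoUniformlyOn_comp_prodMk isCompact_Icc continuousOn_id ha
      (q := fun r t => p t - unitaryGroup A (t - r) (p t))
      ((hpc.comp continuous_snd).sub (hU.continuous_apply (continuous_snd.sub continuous_fst)
        (hpc.comp continuous_snd)))
    simpa [hU.map_zero] using this
  have hR2 := tendstoUniformlyOn_integral_smul_sub hβ hβbar hβw hβdom (x := fun s => q s s)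
    (y := fun n s => q (a n s) s) (hq.comp (continuous_id.prodMk continuous_id))
    (fun n => hq.comp ((hac n).prodMk continuous_id))
    (tendstoUniformlyOn_comp_prodMk isCompact_Icc continuousOn_id ha hq)
  have hκ := hβbar.const_mul_abs (L * 2)
  set C := Real.exp (2 * ∫ s in (0 : ℝ)..S, (L * 2 : ℝ) * |βbar s|) with hC
  have hCpos : 0 < C := Real.exp_pos _
  -- Two consistency errors of this size, times the Gronwall factor `2 * C`, give exactly `min ε δ`.
  have hη : 0 < min ε δ / (4 * C) := by positivity
  rw [Metric.tendstoUniformlyOn_iff] at hR1 hR2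
  filter_upwards [hR1 _ hη, hR2 _ hη] with n hn1 hn2
  obtain ⟨w, hwc, hw⟩ := exists_interaction_picture_solution hA hF hFL (hα n) (hβ n) u₀ hS
  have hUa : ∀ {f : ℝ → H}, Continuous f → ∀ t, IntervalIntegrable
      (fun s => β n s • -(I • unitaryGroup A (-a n s) (f s))) volume 0 t := fun hf t =>
    (hβ n).intervalIntegrable.smul_continuousOn
      ((hU.continuous_apply (hac n).neg hf).const_smul I).neg.continuousOn
  have hFw : Continuous fun s => F s (w s) := hF.comp (continuous_id.prodMk hwc)
  have hle : ∀ t ∈ Icc 0 S, ‖w t - u t‖ ≤ 2 * (min ε δ / (4 * C) + min ε δ / (4 * C)) * C := by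
    refine le_of_le_add_integral_mul hκ (fun s => by positivity) (hwc.sub huc).norm.continuousOn
      (by positivity) fun t ht => ?_
    have hn1t := hn1 t ht
    have hn2t := hn2 t ht
    rw [dist_zero_left] at hn1t hn2t
    have e1 : unitaryGroup A (t - a n t) (p t) = unitaryGroup A (-a n t) (u t) := by
      rw [sub_eq_neg_add, hU.map_add]
      change unitaryGroup A (-a n t) (unitaryGroup A t (p t)) = _
      rw [hU.apply_neg_apply]
    -- The error splits into the phase error of `u`, the error in its Duhamel integral, and a
    -- Lipschitz term for Gronwall.
    have e2 : unitaryGroup A (-a n t) (w t - u t) =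
        ((p t - unitaryGroup A (t - a n t) (p t)) +
          ((∫ s in (0 : ℝ)..t, β n s • q (a n s) s) - ∫ s in (0 : ℝ)..t, q s s)) +
        ∫ s in (0 : ℝ)..t, β n s • -(I • unitaryGroup A (-a n s) (F s (w s) - B (u s))) := by
      simp only [map_sub, smul_sub, neg_sub', sub_neg_eq_add]
      have e3 : ∀ s, β n s • (-(I • unitaryGroup A (-a n s) (F s (w s))) +
          I • unitaryGroup A (-a n s) (B (u s))) =
          β n s • -(I • unitaryGroup A (-a n s) (F s (w s))) - β n s • q (a n s) s := by
        intro s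
        rw [← smul_sub, sub_neg_eq_add]
      simp only [e3]
      rw [intervalIntegral.integral_sub (hUa hFw t) (hUa hfc t), e1, hp t ht]
      have := hw t ht
      change unitaryGroup A (-a n t) (w t) = _ at this
      rw [this]
      abel
    rw [← hU.norm_apply (-a n t), e2]
    refine (norm_add_le _ _).trans (add_le_add ((norm_add_le _ _).trans
      (add_le_add hn1t.le hn2t.le)) ?_)
    refine intervalIntegral.norm_integral_le_of_norm_le ht.1 ?_
      (hκ.intervalIntegrable.mul_continuousOn (hwc.sub huc).norm.continuousOn)
    filter_upwards [hβdom n] with s hs _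
    rw [norm_smul, norm_neg, norm_smul, Complex.norm_I, one_mul, hU.norm_apply, Real.norm_eq_abs,
      ← hFu s, ← dist_eq_norm, mul_comm (L * 2 : ℝ), mul_assoc, ← dist_eq_norm (w s)]
    exact mul_le_mul (hs.trans (le_abs_self _)) (by simpa using (hFL s).dist_le_mul _ _)
      dist_nonneg (abs_nonneg _)
  have hle' : ∀ t ∈ Icc 0 S, ‖w t - u t‖ ≤ min ε δ := fun t ht =>
    (hle t ht).trans_eq (by field_simp; ring)
  refine ⟨w, (isSolutionOn_iff hA hBc (hα n) (hβ n)).2 ⟨hwc.continuousOn, fun t ht => ?_⟩,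
    fun t ht => (hle' t ht).trans (min_le_left _ _)⟩
  rw [hw t ht]
  congr 1
  refine intervalIntegral.integral_congr fun s hs => ?_
  rw [uIcc_of_le ht.1] at hs
  -- `w` never leaves the tube, so it solves the untruncated equation.
  have hs' := (hle' s ⟨hs.1, hs.2.trans ht.2⟩).trans (min_le_right _ _)
  simp only [F, radialRetraction_of_norm_le hδ hs', add_sub_cancel]

end Convergence

end AbstractSplitting

open AbstractSplitting in
theorem theorem3p1 {H : Type*} [NormedAddCommGroup H] [InnerProductSpace ℂ H] [CompleteSpace H]
    (A : H →ₗ.[ℂ] H) (hA : IsSelfAdjoint A)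
    (B : H → H) (hB : LocallyLipschitz B)
    (α β : ℕ → ℝ → ℝ) (αbar βbar : ℝ → ℝ)
    (hα : ∀ n, LocallyIntegrable (α n)) (hβ : ∀ n, LocallyIntegrable (β n))
    (hαbar : LocallyIntegrable αbar) (hβbar : LocallyIntegrable βbar)
    (hαw : WeaklyConvergesTo α (fun _ => 1)) (hβw : WeaklyConvergesTo β (fun _ => 1))
    (hαdom : ∀ n, ∀ᵐ t, |α n t| ≤ αbar t) (hβdom : ∀ n, ∀ᵐ t, |β n t| ≤ βbar t)
    (u₀ : H) (T : ℝ) (hT : 0 ≤ T)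
    (hTmax : (T : EReal) < maximalTime A B (fun _ => 1) (fun _ => 1) u₀) :
    IsUniqueSolutionOn A B (fun _ => 1) (fun _ => 1) u₀ T
        (flow A B (fun _ => 1) (fun _ => 1) u₀) ∧
      (∃ n₀ : ℕ, ∀ n ≥ n₀, (T : EReal) < maximalTime A B (α n) (β n) u₀ ∧
        IsUniqueSolutionOn A B (α n) (β n) u₀ T (flow A B (α n) (β n) u₀)) ∧
      TendstoUniformlyOn (fun n => flow A B (α n) (β n) u₀)
        (flow A B (fun _ => 1) (fun _ => 1) u₀) atTop (Icc 0 T) := by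
  have h1 : LocallyIntegrable (fun _ : ℝ => (1 : ℝ)) := continuous_const.locallyIntegrable
  -- Working up to some `S > T` makes the inequality `T < T*_n` strict.
  obtain ⟨-, ⟨S, ⟨hS, u, hu⟩, rfl⟩, hTS⟩ := lt_sSup_iff.1 hTmax
  have hTS' : T ≤ S := (EReal.coe_lt_coe_iff.1 hTS).le
  have key := fun {ε : ℝ} (hε : 0 < ε) => eventually_exists_isSolutionOn hA hB hα hβ hαbar hβbar
    hαw hβw hαdom hβdom hS hu hε
  refine ⟨(hu.mono hTS').isUniqueSolutionOn_flow hA hB h1 h1, ?_, ?_⟩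
  · obtain ⟨n₀, hn₀⟩ := eventually_atTop.1 (key one_pos)
    refine ⟨n₀, fun n hn => ?_⟩
    obtain ⟨w, hw, -⟩ := hn₀ n hn
    exact ⟨hTS.trans_le (le_sSup ⟨S, ⟨hS, w, hw⟩, rfl⟩),
      (hw.mono hTS').isUniqueSolutionOn_flow hA hB (hα n) (hβ n)⟩
  · rw [Metric.tendstoUniformlyOn_iff]
    intro ε hε
    filter_upwards [key (half_pos hε)] with n ⟨w, hw, hwu⟩ t ht
    have ht' : t ∈ Icc 0 S := ⟨ht.1, ht.2.trans hTS'⟩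
    rw [hu.eqOn_flow hA hB h1 h1 ht', hw.eqOn_flow hA hB (hα n) (hβ n) ht', dist_comm,
      dist_eq_norm]
    exact (hwu t ht').trans_lt (half_lt_self hε)
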